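/- Let $g>1$. A \emph{Feynman graph} of genus $g$ is a connected trivalent graph $\Gamma$ (multiple edges and loops allowed) of first Betti number $g$, with its vertices labeled $x_1,\dots,x_{2g-2}$ and its edges labeled $q_1,\dots,q_{3g-3}$; one such reference labeling is fixed for each isomorphism class of unlabeled graphs. \textbf{Labeled tropical covers.} Let $E=\mathbb R/L\mathbb Z$ ($L>0$) be a tropical elliptic curve, $p_1,\dots,p_{2g-2}\in E$ pairwise distinct points, and $p_0\in E$ a base point different from all $p_i$. A labeled tropical cover of type $\Gamma$ is a metric graph $C$ (positive edge lengths) with underlying labeled graph $\Gamma$ together with a non-constant continuous map $\pi:C\to E$ that is affine with integer slope on each edge and balanced at each vertex: the weights of the rays mapping to the two sides of the image of the vertex have equal sums, where the weight $w_k$ of $q_k$ is the absolute value of the slope of $\pi$ on $q_k$. Its branch points are the images of the vertices; its degree is $\sum_k w_k\cdot\#(\pi^{-1}(p)\cap q_k)$ for any $p\in E$ that is not a branch point. Isomorphisms are isometries over $E$ that respect all labels. For $\underline a=(a_1,\dots,a_{3g-3})\in\mathbb N_{\ge0}^{3g-3}$, let $N^{\mathrm{trop}}_{\underline a,\Gamma}$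 be the number of isomorphism classes of labeled tropical covers of type $\Gamma$ and degree $\sum_k a_k$, with set of branch points $\{p_1,\dots,p_{2g-2}\}$ and with $\#(\pi^{-1}(p_0)\cap q_k)\cdot w_k=a_k$ for all $k$, each counted with multiplicity $\prod_k w_k$. Let $N^{\mathrm{trop}}_{\underline a,g}$ be the same count over all Feynman graphs $\Gamma$ of genus $g$, and put $q^{2\underline a}=\prod_k q_k^{2a_k}$ and $F_g(q_1,\dots,q_{3g-3})=\sum_{\underline a}N^{\mathrm{trop}}_{\underline a,g}\,q^{2\underline a}$. \textbf{Refined Feynman integrals.} For $q=e^{i\pi\tau}$ with $\operatorname{Im}\tau>0$ let $P(z,q)=\frac1{4\pi^2}\wp(z,q)+\frac1{12}E_2(q^2)$, where $\wp(\cdot,q)$ is the Weierstrass function of the lattice $\mathbb Z+\mathbb Z\tau$ and $E_2(q)=1-24\sum_{d\ge1}\sigma_1(d)q^d$. Let $\Gamma$ be a Feynman graph without loops, and let $q_k=e^{i\pi\tau_k}$ with $\operatorname{Im}\tau_k>0$. For a total order $\Omega$ of the vertices choose real numbers $y_1,\dots,y_{2g-2}$ ordered according to $\Omega$, pairwise different,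 with $|y_i-y_j|<\operatorname{Im}\tau_k$ for all $i,j,k$, let $\gamma_j(t)=iy_j+t$ for $t\in[0,1]$, and put $$I_{\Gamma,\Omega}(q_1,\dots,q_{3g-3})=\int_{z_j\in\gamma_j}\prod_{k=1}^{3g-3}\bigl(-P(z_{k_1}-z_{k_2},q_k)\bigr),\qquad I_\Gamma=\sum_\Omega I_{\Gamma,\Omega},$$ where $x_{k_1},x_{k_2}$ are the end vertices of $q_k$ and the sum is over all $(2g-2)!$ orders. \textbf{Theorem (Tropical mirror symmetry for elliptic curves).} All the counts above are finite, and $N^{\mathrm{trop}}_{\underline a,\Gamma}=0$ for all $\underline a$ if $\Gamma$ has a loop. The integrals $I_{\Gamma,\Omega}$ exist, and for all $q_k$ with $0<|q_k|<1$ and all admissible choices of the $y_j$, with absolutely convergent series, $$F_g(q_1,\dots,q_{3g-3})=\sum_{\underline a}N^{\mathrm{trop}}_{\underline a,g}\,q^{2\underline a}=\sum_\Gamma I_\Gamma(q_1,\dots,q_{3g-3}),$$ where $\Gamma$ runs over the Feynman graphs of genus $g$ without loops. More precisely, for each such $\Gamma$, $$I_\Gamma(q_1,\dots,q_{3g-3})=\sum_{\underline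 a}N^{\mathrm{trop}}_{\underline a,\Gamma}\,q^{2\underline a},$$ that is, the coefficient of $q^{2\underline a}$ in $I_\Gamma$ is $N^{\mathrm{trop}}_{\underline a,\Gamma}$ (and monomials that are not of the form $q^{2\underline a}$ do not occur). The same holds if $F_g$ and the sum over $\Gamma$ are taken over all labelings of all Feynman graphs instead of one reference labeling for each. -/

import Mathlib

open scoped BigOperators

noncomputable section

namespace TropicalMirror

/-! ### Feynman graphs -/

/-- A graph with `2g-2` vertices labeled by `Fin (2g-2)` and `3g-3` edges labeled by `Fin (3g-3)`;
the edge `q_k` joins the two (possibly equal) vertices in `Γ k`. A label-preserving isomorphism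
of such graphs is an equality. -/
abbrev LabeledGraph (g : ℕ) : Type := Fin (3 * g - 3) → Sym2 (Fin (2 * g - 2))

namespace LabeledGraph

variable {g : ℕ}

/-- The valence of a vertex; a loop counts twice. -/
def valence (Γ : LabeledGraph g) (v : Fin (2 * g - 2)) : ℕ :=
  ∑ k, (Γ k).toMultiset.count v

/-- Two vertices are neighbours if some edge joins them. -/
def toSimpleGraph (Γ : LabeledGraph g) : SimpleGraph (Fin (2 * g - 2)) :=
  SimpleGraph.fromRel fun u v => ∃ k, Γ k = s(u, v)

/-- Trivalent connected graphs. With `2g-2` vertices and `3g-3` edges, the first Betti number of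
a connected graph is `g`; conversely a trivalent connected graph with first Betti number `g > 1`
has `2g-2` vertices and `3g-3` edges. -/
structure IsFeynman (Γ : LabeledGraph g) : Prop where
  trivalent : ∀ v, Γ.valence v = 3
  connected : Γ.toSimpleGraph.Connected

/-- No edge joins a vertex to itself. -/
def Loopless (Γ : LabeledGraph g) : Prop := ∀ k, ¬ (Γ k).IsDiag

/-- Isomorphism of the underlying graphs, forgetting the labels. -/
def UnlabeledIso (Γ Γ' : LabeledGraph g) : Prop :=
  ∃ (σ : Equiv.Perm (Fin (2 * g - 2))) (ρ : Equiv.Perm (Fin (3 * g - 3))),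
    ∀ k, Γ' (ρ k) = (Γ k).map σ

/-- A choice of one reference labeling for every (unlabeled) Feynman graph of genus `g`. -/
structure IsReferenceSystem (R : Finset (LabeledGraph g)) : Prop where
  isFeynman : ∀ Γ ∈ R, IsFeynman Γ
  existsUnique : ∀ Γ : LabeledGraph g, IsFeynman Γ → ∃! Γ', Γ' ∈ R ∧ UnlabeledIso Γ Γ'

end LabeledGraph

/-! ### Tropical curves and labeled tropical covers -/

/-- A tropical curve of genus `g` with labeled vertices and edges: a connected trivalent graph with
a positive length on each edge. The edge `k` is parametrized by `[0, len k]`, running from `src k`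
to `tgt k`; the direction of the parametrization is auxiliary, isomorphisms may reverse it. -/
structure TropicalCurve (g : ℕ) where
  src : Fin (3 * g - 3) → Fin (2 * g - 2)
  tgt : Fin (3 * g - 3) → Fin (2 * g - 2)
  len : Fin (3 * g - 3) → ℝ
  len_pos : ∀ k, 0 < len k
  isFeynman : LabeledGraph.IsFeynman (fun k => s(src k, tgt k) : LabeledGraph g)

namespace TropicalCurve

variable {g : ℕ} (C : TropicalCurve g)

/-- The combinatorial type together with the labels. -/
def combType : LabeledGraph g := fun k => s(C.src k, C.tgt k)

/-- The start of the edge `k` as an element of its parameter interval. -/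
def start (k : Fin (3 * g - 3)) : Set.Icc (0 : ℝ) (C.len k) :=
  ⟨0, le_refl _, (C.len_pos k).le⟩

/-- The end of the edge `k` as an element of its parameter interval. -/
def finish (k : Fin (3 * g - 3)) : Set.Icc (0 : ℝ) (C.len k) :=
  ⟨C.len k, (C.len_pos k).le, le_refl _⟩

/-- Vertices and edges before gluing. -/
abbrev Pieces : Type := Fin (2 * g - 2) ⊕ (Σ k : Fin (3 * g - 3), Set.Icc (0 : ℝ) (C.len k))

/-- The ends of each edge are glued to its end vertices. -/
inductive Glue : C.Pieces → C.Pieces → Prop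
  | start (k : Fin (3 * g - 3)) : Glue (Sum.inr ⟨k, C.start k⟩) (Sum.inl (C.src k))
  | finish (k : Fin (3 * g - 3)) : Glue (Sum.inr ⟨k, C.finish k⟩) (Sum.inl (C.tgt k))

/-- The topological space underlying the metric graph. -/
def Point : Type := Quot C.Glue

instance : TopologicalSpace C.Point := inferInstanceAs (TopologicalSpace (Quot C.Glue))

/-- The vertex `x_v` as a point of the curve. -/
def vertex (v : Fin (2 * g - 2)) : C.Point := Quot.mk _ (Sum.inl v)

/-- The point with parameter `t` on the edge `q_k`. -/
def edgePoint (k : Fin (3 * g - 3)) (t : Set.Icc (0 : ℝ) (C.len k)) : C.Point :=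
  Quot.mk _ (Sum.inr ⟨k, t⟩)

/-- The vertex from which a ray emanates: the rays are the two ends of each edge,
`(k, false)` at `src k` and `(k, true)` at `tgt k`. -/
def rayVertex (r : Fin (3 * g - 3) × Bool) : Fin (2 * g - 2) :=
  if r.2 then C.tgt r.1 else C.src r.1

end TropicalCurve

/-- The slope of a ray in the direction pointing away from its vertex, where `s k` is the slope of
the edge `k` in the direction of its parametrization. -/
def raySlope {m : ℕ} (s : Fin m → ℤ) (r : Fin m × Bool) : ℤ :=
  if r.2 then - s r.1 else s r.1

/-- A tropical cover, with labels, of the tropical elliptic curve `ℝ / L ℤ`. -/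
structure LabeledCover (g : ℕ) (L : ℝ) where
  curve : TropicalCurve g
  map : curve.Point → AddCircle L
  continuous_map : Continuous map
  nonconstant : ∃ x y, map x ≠ map y
  /-- The slope of the map on each edge; it is determined by the map. -/
  slope : Fin (3 * g - 3) → ℤ
  affine : ∀ k t, map (curve.edgePoint k t)
    = map (curve.edgePoint k (curve.start k)) + (((slope k : ℝ) * (t : ℝ) : ℝ) : AddCircle L)
  /-- At each vertex, the weights of the rays mapping to one side of its image and the weights of
  the rays mapping to the other side have the same sum. -/
  balanced : ∀ v,
    ∑ r with curve.rayVertex r = v ∧ 0 < raySlope slope r, (raySlope slope r).natAbs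
      = ∑ r with curve.rayVertex r = v ∧ raySlope slope r < 0, (raySlope slope r).natAbs

namespace LabeledCover

variable {g : ℕ} {L : ℝ}

/-- The weight of an edge. -/
def weight (c : LabeledCover g L) (k : Fin (3 * g - 3)) : ℕ := (c.slope k).natAbs

/-- The preimages of `x` on the edge `q_k`. -/
def fiber (c : LabeledCover g L) (k : Fin (3 * g - 3)) (x : AddCircle L) : Set c.curve.Point :=
  {P | c.map P = x ∧ P ∈ Set.range (c.curve.edgePoint k)}

/-- Every point that is not the image of a vertex has `d` preimages, counted with the weights of
the edges on which they lie. -/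
def HasDegree (c : LabeledCover g L) (d : ℕ) : Prop :=
  ∀ x : AddCircle L, (∀ v, c.map (c.curve.vertex v) ≠ x) →
    ∑ k, (c.fiber k x).ncard * c.weight k = d

/-- The multiplicity with which a labeled cover is counted. -/
def mult (c : LabeledCover g L) : ℕ := ∏ k, c.weight k

/-- Isomorphism of labeled covers: a homeomorphism of the source curves that maps the vertex `x_v`
to `x_v` and the edge `q_k` isometrically to `q_k`, and is compatible with the maps to the
elliptic curve. -/
def Iso (c c' : LabeledCover g L) : Prop :=
  ∃ φ : c.curve.Point ≃ₜ c'.curve.Point,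
    (∀ v, φ (c.curve.vertex v) = c'.curve.vertex v) ∧
    (∀ k, ∃ ι : Set.Icc (0 : ℝ) (c.curve.len k) ≃ᵢ Set.Icc (0 : ℝ) (c'.curve.len k),
      ∀ t, φ (c.curve.edgePoint k t) = c'.curve.edgePoint k (ι t)) ∧
    ∀ P, c'.map (φ P) = c.map P

instance isoSetoid (g : ℕ) (L : ℝ) : Setoid (LabeledCover g L) where
  r := Iso
  iseqv := by
    refine ⟨fun c => ⟨Homeomorph.refl _, fun _ => rfl, fun k => ⟨IsometryEquiv.refl _, fun _ => rfl⟩,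
      fun _ => rfl⟩, ?_, ?_⟩
    · rintro c c' ⟨φ, hv, he, hm⟩
      refine ⟨φ.symm, fun v => by rw [← hv v, φ.symm_apply_apply], fun k => ?_, fun P => ?_⟩
      · obtain ⟨ι, hι⟩ := he k
        refine ⟨ι.symm, fun t => ?_⟩
        rw [φ.symm_apply_eq, hι, ι.apply_symm_apply]
      · rw [← hm, φ.apply_symm_apply]
    · rintro c c' c'' ⟨φ, hv, he, hm⟩ ⟨φ', hv', he', hm'⟩
      refine ⟨φ.trans φ', fun v => by simp [hv, hv'], fun k => ?_, fun P => by simp [hm, hm']⟩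
      obtain ⟨ι, hι⟩ := he k
      obtain ⟨ι', hι'⟩ := he' k
      exact ⟨ι.trans ι', fun t => by simp [hι, hι']⟩

theorem map_sub (c : LabeledCover g L) (k : Fin (3 * g - 3))
    (t u : Set.Icc (0 : ℝ) (c.curve.len k)) :
    c.map (c.curve.edgePoint k t) - c.map (c.curve.edgePoint k u)
      = (((c.slope k : ℝ) * ((t : ℝ) - u) : ℝ) : AddCircle L) := by
  rw [c.affine k t, c.affine k u, mul_sub, AddCircle.coe_sub]
  abel

theorem weight_eq_of_iso [hL : Fact (0 < L)] {c c' : LabeledCover g L} (h : Iso c c')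
    (k : Fin (3 * g - 3)) : c.weight k = c'.weight k := by
  obtain ⟨φ, -, he, hm⟩ := h
  obtain ⟨ι, hι⟩ := he k
  have hL0 : 0 < L := hL.out
  set M : ℝ := 2 * (|(c.slope k : ℝ)| + |(c'.slope k : ℝ)| + 1) with hM
  have hMpos : 0 < M := by positivity
  obtain ⟨ε, hε0, hε1, hε2⟩ : ∃ ε : ℝ, 0 < ε ∧ ε ≤ c.curve.len k ∧ ε * M ≤ L := by
    refine ⟨min (c.curve.len k) (L / M), lt_min (c.curve.len_pos k) (by positivity),
      min_le_left _ _, ?_⟩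
    calc min (c.curve.len k) (L / M) * M ≤ L / M * M := by gcongr; exact min_le_right _ _
      _ = L := by field_simp
  let t : Set.Icc (0 : ℝ) (c.curve.len k) := ⟨ε, hε0.le, hε1⟩
  have h1 := c.map_sub k t (c.curve.start k)
  have h2 := c'.map_sub k (ι t) (ι (c.curve.start k))
  rw [← hι, ← hι, hm, hm, h1] at h2
  have hd : |((ι t : ℝ) - (ι (c.curve.start k) : ℝ))| = ε := by
    have := ι.dist_eq t (c.curve.start k)
    rw [Subtype.dist_eq, Subtype.dist_eq, Real.dist_eq, Real.dist_eq] at this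
    rw [this]
    simp [t, TropicalCurve.start, abs_of_pos hε0]
  have h0 : |((t : ℝ) - (c.curve.start k : ℝ))| = ε := by
    simp [t, TropicalCurve.start, abs_of_pos hε0]
  have hb : ∀ x : ℝ, |x| ≤ L / 2 → ‖(x : AddCircle L)‖ = |x| := fun x hx =>
    (AddCircle.norm_coe_eq_abs_iff L hL0.ne').2 (by rwa [abs_of_pos hL0])
  have h3 := congrArg norm h2
  have hs := abs_nonneg (c.slope k : ℝ)
  have hs' := abs_nonneg (c'.slope k : ℝ)
  rw [hb _ (by rw [abs_mul, h0]; nlinarith), hb _ (by rw [abs_mul, hd]; nlinarith),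
    abs_mul, abs_mul, h0, hd] at h3
  have h4 := mul_right_cancel₀ hε0.ne' h3
  unfold weight
  have h5 : |c.slope k| = |c'.slope k| := by exact_mod_cast h4
  exact Int.natAbs_eq_natAbs_iff.2 (abs_eq_abs.1 h5)

/-- Labeled tropical covers up to isomorphism. -/
abbrev IsoClass (g : ℕ) (L : ℝ) : Type := Quotient (isoSetoid g L)

/-- The multiplicity of an isomorphism class. -/
def IsoClass.mult [Fact (0 < L)] (x : IsoClass g L) : ℕ :=
  Quotient.lift LabeledCover.mult
    (fun _ _ h => Finset.prod_congr rfl fun k _ => weight_eq_of_iso h k) x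

/-- The cover has its branch points at the points `p i`, branch type `a` at `p₀`, and the
corresponding degree. -/
structure HasBranchType (c : LabeledCover g L) (p₀ : AddCircle L)
    (p : Fin (2 * g - 2) → AddCircle L) (a : Fin (3 * g - 3) → ℕ) : Prop where
  branchPoints : Set.range (fun v => c.map (c.curve.vertex v)) = Set.range p
  degree : c.HasDegree (∑ k, a k)
  branchType : ∀ k, (c.fiber k p₀).ncard * c.weight k = a k

/-- The isomorphism classes of labeled covers of branch type `a` whose combinatorial type (with
labels) lies in `S`. -/
def classes (p₀ : AddCircle L) (p : Fin (2 * g - 2) → AddCircle L)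
    (S : Set (LabeledGraph g)) (a : Fin (3 * g - 3) → ℕ) : Set (IsoClass g L) :=
  {x | ∃ c : LabeledCover g L, ⟦c⟧ = x ∧ c.curve.combType ∈ S ∧ c.HasBranchType p₀ p a}

end LabeledCover

/-- The weighted number of labeled tropical covers of branch type `a`, with the prescribed branch
points, whose combinatorial type lies in `S`: this is `N_{a,Γ}` for `S = {Γ}`, and `N_{a,g}` if `S`
is the set of all Feynman graphs of genus `g`. -/
def tropCount {g : ℕ} {L : ℝ} [Fact (0 < L)] (p₀ : AddCircle L)
    (p : Fin (2 * g - 2) → AddCircle L) (S : Set (LabeledGraph g)) (a : Fin (3 * g - 3) → ℕ) : ℕ :=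
  ∑ᶠ x ∈ LabeledCover.classes p₀ p S a, LabeledCover.IsoClass.mult x

/-! ### The propagator and Feynman integrals -/

/-- The periods `1, τ`. -/
def periodPair (τ : UpperHalfPlane) : PeriodPair where
  ω₁ := 1
  ω₂ := τ
  indep := by
    rw [LinearIndependent.pair_iff]
    intro s t h
    have him := congrArg Complex.im h
    have hre := congrArg Complex.re h
    have hτ : (τ : ℂ).im ≠ 0 := τ.im_pos.ne'
    simp at him hre
    have ht : t = 0 := him.resolve_right (by simpa using hτ)
    subst ht
    simpa using hre

/-- The coordinate `q = exp(iπτ)` on the punctured unit disc. -/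
def qCoord (τ : UpperHalfPlane) : ℂ := Complex.exp (Complex.I * Real.pi * τ)

/-- `E₂(q) = 1 - 24 ∑_{d ≥ 1} σ(d) q^d`. -/
def eisensteinE2 (q : ℂ) : ℂ :=
  1 - 24 * ∑' d : ℕ, (ArithmeticFunction.sigma 1 (d + 1) : ℂ) * q ^ (d + 1)

/-- The propagator `P(z,q) = ℘(z,q) / (4π²) + E₂(q²) / 12` at `q = exp(iπτ)`, where `℘(·,q)` is the
Weierstrass function of the lattice `ℤ + ℤτ`. -/
def propagator (z : ℂ) (τ : UpperHalfPlane) : ℂ :=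
  1 / (4 * Real.pi ^ 2) * (periodPair τ).weierstrassP z + 1 / 12 * eisensteinE2 (qCoord τ ^ 2)

theorem propagator_neg (z : ℂ) (τ : UpperHalfPlane) : propagator (-z) τ = propagator z τ := by
  simp [propagator]

/-- The factor `-P(z_i - z_j, q_k)` of an edge with end vertices `x_i`, `x_j`. -/
def edgeFactor {n : ℕ} (z : Fin n → ℂ) (τ : UpperHalfPlane) (e : Sym2 (Fin n)) : ℂ :=
  Sym2.lift ⟨fun i j => - propagator (z i - z j) τ, fun i j => by
    show - propagator (z i - z j) τ = - propagator (z j - z i) τ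
    rw [← propagator_neg, neg_sub]⟩ e

/-- The integrand `∏_k (-P_k)` at the points `z_j = i y_j + t_j` of the integration paths. -/
def integrand {g : ℕ} (Γ : LabeledGraph g) (τ : Fin (3 * g - 3) → UpperHalfPlane)
    (y t : Fin (2 * g - 2) → ℝ) : ℂ :=
  ∏ k, edgeFactor (fun j => Complex.I * y j + t j) (τ k) (Γ k)

/-- The integral of `∏_k (-P_k)` over the paths `γ_j : [0,1] → ℂ, t ↦ i y_j + t`. -/
def feynmanIntegralAt {g : ℕ} (Γ : LabeledGraph g) (τ : Fin (3 * g - 3) → UpperHalfPlane)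
    (y : Fin (2 * g - 2) → ℝ) : ℂ :=
  ∫ t in Set.Icc (0 : Fin (2 * g - 2) → ℝ) 1, integrand Γ τ y t

/-- Starting points `i y_j` of the integration paths for the vertex order in which `x_j` is at
position `Ω j`. They are so small that every difference `z_i - z_j` stays in the strip
`|Im z| < Im τ_k`, where the only poles of the propagator are the integers. -/
structure IsStart {g : ℕ} (τ : Fin (3 * g - 3) → UpperHalfPlane)
    (Ω : Equiv.Perm (Fin (2 * g - 2))) (y : Fin (2 * g - 2) → ℝ) : Prop where
  order : ∀ i j, Ω i < Ω j → y i < y j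
  small : ∀ i j k, |y i - y j| < (τ k).im

/-- The refined Feynman integral `I_Γ = ∑_Ω I_{Γ,Ω}`, computed with the starting points
`y Ω` for the order `Ω`. -/
def feynmanIntegral {g : ℕ} (Γ : LabeledGraph g) (τ : Fin (3 * g - 3) → UpperHalfPlane)
    (y : Equiv.Perm (Fin (2 * g - 2)) → Fin (2 * g - 2) → ℝ) : ℂ :=
  ∑ Ω, feynmanIntegralAt Γ τ (y Ω)

/-- The monomial `q^{2a}`. -/
def qMonomial {m : ℕ} (τ : Fin m → UpperHalfPlane) (a : Fin m → ℕ) : ℂ :=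
  ∏ k, qCoord (τ k) ^ (2 * a k)

end TropicalMirror

end

/-! Both sides count the same objects: pairs of a vertex order Ω and a balanced integral flow on Γ
in which every edge carries a winding number n ∈ ℤ and a weight w ≥ 1.

Analytic side. Summing ℘ row by row over the lattice with Lipschitz's formula gives, for 0 < Im z <
Im τ, the expansion -P(z,q) = ∑ w q^{2w|n|} e^{2πi s z} over all (n, w), where s = w for n ≥ 0 and s
= -w for n < 0 (`hasSum_strandTerm`). Since P is even, each edge may be oriented from its lower to
its higher end with respect to Ω, and the starting points then keep every difference in this strip.
In the product over the edges the frequency in z_v is the net inflow at v. Integration over one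
period in each variable therefore keeps exactly the balanced flows
(`hasSum_integral_orientedIntegrand`).

Tropical side. Cut E at p₀ and lift the branch points to b < X_1 < ... < X_N < b + L; the images of
its vertices equip a cover with an order Ω. An edge of length ℓ whose slope from the lower to the
higher end is s satisfies sℓ = D + nL with 0 < D < L. So s has the sign of n (0 counting as
positive), (n, w) determines ℓ, and every (n, w) gives a positive ℓ. Such an edge has |n| points
over p₀, hence a_k = w|n|, and balancing is flow conservation. Thus isomorphism classes of covers
correspond to pairs of an order and a balanced flow (`flowClass_bijective`), with weight ∏ w on both
sides.

Finiteness of the counts is read off from convergence of the flow series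
(`finite_flowSet_of_start`). Loops are excluded because the third edge at a loop would have slope
zero, against the branch points being distinct (`loopless_of_injective`). -/

namespace TropicalMirror

/-! ### The expansion of the propagator -/

/-- The signed slope of a strand that has weight `d.2` and winds `d.1` times around the circle: the
slope has the same sign as the winding number, where `0` counts as positive. -/
def strandSlope (d : ℤ × ℕ+) : ℤ := if 0 ≤ d.1 then (d.2 : ℤ) else -(d.2 : ℤ)

/-- The weighted number of preimages of the base point on a strand. -/
def strandDegree (d : ℤ × ℕ+) : ℕ := d.2 * d.1.natAbs

/-- The summand of the expansion of `-P(z, q)` that belongs to a strand. -/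
noncomputable def strandTerm (τ : UpperHalfPlane) (z : ℂ) (d : ℤ × ℕ+) : ℂ :=
  (d.2 : ℂ) * qCoord τ ^ (2 * strandDegree d)
    * Complex.exp (2 * Real.pi * Complex.I * (strandSlope d * z))

/-- `z + n τ` for `n ≥ 0` and `- z - n τ` for `n < 0`. -/
noncomputable def shiftedPoint (τ : UpperHalfPlane) (z : ℂ) (n : ℤ) : ℂ :=
  if 0 ≤ n then z + n * τ else -z - n * τ

/-- For fixed n this turns the terms into those of Lipschitz's series at `shiftedPoint τ z n`, which
lies in the upper half plane when z is in the strip. The sign change for n < 0 serves this purpose.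
-/
theorem strandTerm_eq (τ : UpperHalfPlane) (z : ℂ) (n : ℤ) (w : ℕ+) :
    strandTerm τ z (n, w)
      = (w : ℂ) * Complex.exp (2 * Real.pi * Complex.I * shiftedPoint τ z n) ^ (w : ℕ) := by
  unfold strandTerm strandDegree strandSlope shiftedPoint qCoord
  rw [mul_assoc, ← Complex.exp_nat_mul, ← Complex.exp_nat_mul, ← Complex.exp_add]
  congr 2
  rcases le_or_gt 0 n with h | h
  · lift n to ℕ using h
    simp
    ring
  · obtain ⟨m, rfl⟩ : ∃ m : ℕ, n = -(m : ℤ) := ⟨n.natAbs, by omega⟩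
    have : ¬ (0 : ℤ) ≤ -(m : ℤ) := by omega
    simp only [this, if_false, Int.natAbs_neg, Int.natAbs_natCast]
    push_cast
    ring

/-- Linear growth of the imaginary parts, with row n paired with row -(n+1); it makes the double
series comparable to a Lambert series. -/
theorem le_im_shiftedPoint {τ : UpperHalfPlane} {z : ℂ} {δ : ℝ} (h0 : δ ≤ z.im)
    (h1 : δ ≤ τ.im - z.im) (n : ℕ) :
    (n + 1) * δ ≤ (shiftedPoint τ z n).im ∧
      (n + 1) * δ ≤ (shiftedPoint τ z (-((n : ℤ) + 1))).im := by
  have hn : ¬ (0 : ℤ) ≤ -((n : ℤ) + 1) := by omega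
  have h2 : δ ≤ τ.im := by
    rcases le_or_gt 0 δ with h | h
    · linarith
    · exact h.le.trans τ.im_pos.le
  have h3 : (n : ℝ) * δ ≤ n * τ.im := by gcongr
  simp only [shiftedPoint, hn, if_false, Int.natCast_nonneg, if_true]
  constructor
  · simp
    linarith
  · simp
    linarith

/-- Each half, n ≥ 0 and n < 0, is dominated by the Lambert series ∑ w ρ^{(n+1)w} with ρ = e^{-2πδ},
where δ is the distance of Im z to the boundary of the strip. -/
theorem summable_norm_strandTerm (τ : UpperHalfPlane) {z : ℂ} (h0 : 0 < z.im) (h1 : z.im < τ.im) :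
    Summable fun d => ‖strandTerm τ z d‖ := by
  obtain ⟨δ, hδ, hδ0, hδ1⟩ : ∃ δ > 0, δ ≤ z.im ∧ δ ≤ τ.im - z.im :=
    ⟨min z.im (τ.im - z.im), lt_min h0 (by linarith), min_le_left _ _, min_le_right _ _⟩
  obtain ⟨ρ, hρ⟩ : ∃ ρ : ℝ, ρ = Real.exp (-(2 * Real.pi * δ)) := ⟨_, rfl⟩
  have hρ1 : ‖ρ‖ < 1 := by
    rw [hρ, Real.norm_of_nonneg (Real.exp_pos _).le, Real.exp_lt_one_iff]
    have := Real.pi_pos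
    simp only [neg_lt_zero]
    positivity
  have hs := summable_prod_mul_pow 1 hρ1
  have key : ∀ (n : ℕ) (m : ℤ), (n + 1) * δ ≤ (shiftedPoint τ z m).im → ∀ w : ℕ+,
      ‖strandTerm τ z (m, w)‖ ≤ (w : ℝ) ^ 1 * ρ ^ ((n + 1) * w : ℕ) := by
    intro n m hm w
    rw [strandTerm_eq, norm_mul, norm_pow, pow_one, pow_mul]
    simp only [Complex.norm_natCast]
    gcongr
    rw [Complex.norm_exp, hρ, ← Real.exp_nat_mul]
    apply Real.exp_le_exp.2
    simp
    have := Real.pi_pos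
    have h2 := mul_le_mul_of_nonneg_left hm (by positivity : 0 ≤ 2 * Real.pi)
    linarith
  have hrow : ∀ n : ℕ, Summable fun w : ℕ+ => (w : ℝ) ^ 1 * ρ ^ ((n + 1) * w : ℕ) := fun n => by
    simpa using hs.prod_factor n.succPNat
  have hcol : Summable fun n : ℕ => ∑' w : ℕ+, (w : ℝ) ^ 1 * ρ ^ ((n + 1) * w : ℕ) := by
    simpa using! hs.prod.comp_injective Nat.succPNat_injective
  have hb := le_im_shiftedPoint hδ0 hδ1
  refine (summable_prod_of_nonneg fun _ => norm_nonneg _).2 ⟨fun m => ?_, ?_⟩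
  · rcases le_or_gt 0 m with h | h
    · lift m to ℕ using h
      exact (hrow m).of_nonneg_of_le (fun _ => norm_nonneg _) (key m m (hb m).1)
    · obtain ⟨n, rfl⟩ : ∃ n : ℕ, m = -((n : ℤ) + 1) := ⟨(-m - 1).toNat, by omega⟩
      exact (hrow n).of_nonneg_of_le (fun _ => norm_nonneg _) (key n _ (hb n).2)
  · refine Summable.of_nat_of_neg_add_one ?_ ?_
    · refine hcol.of_nonneg_of_le (fun n => tsum_nonneg fun _ => norm_nonneg _) fun n => ?_
      exact Summable.tsum_le_tsum (key n n (hb n).1)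
        ((hrow n).of_nonneg_of_le (fun _ => norm_nonneg _) (key n n (hb n).1)) (hrow n)
    · refine hcol.of_nonneg_of_le (fun n => tsum_nonneg fun _ => norm_nonneg _) fun n => ?_
      exact Summable.tsum_le_tsum (key n _ (hb n).2)
        ((hrow n).of_nonneg_of_le (fun _ => norm_nonneg _) (key n _ (hb n).2)) (hrow n)

theorem summable_inv_add_int_sq (u : ℂ) : Summable fun n : ℤ => 1 / (u + n) ^ 2 := by
  simpa using! EisensteinSeries.linear_right_summable u 1 (k := 2) le_rfl

/-- Lipschitz's formula in weight 2. -/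
theorem tsum_inv_add_int_sq {u : ℂ} (hu : 0 < u.im) :
    ∑' n : ℤ, 1 / (u + n) ^ 2
      = -(4 * Real.pi ^ 2)
        * ∑' w : ℕ+, (w : ℂ) * Complex.exp (2 * Real.pi * Complex.I * u) ^ (w : ℕ) := by
  have := EisensteinSeries.qExpansion_identity_pnat (k := 1) le_rfl ⟨u, hu⟩
  simp only [Nat.reduceAdd, Nat.factorial_one, Nat.cast_one, div_one, pow_one] at this
  rw [show ((-2 * Real.pi * Complex.I) ^ 2 : ℂ) = -(4 * Real.pi ^ 2) by
    rw [mul_pow, Complex.I_sq]; ring] at this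
  exact this

/-- The row of ℘ through -mτ splits into two absolutely convergent sums: z - (n - mτ) is, up to
sign, `shiftedPoint τ z m` plus an integer, so Lipschitz's formula applies; the correction terms
form a row of the Eisenstein series of weight 2. -/
theorem hasSum_row (τ : UpperHalfPlane) {z : ℂ} (h0 : 0 < z.im) (h1 : z.im < τ.im) (m : ℤ) :
    HasSum (fun n : ℤ => 1 / (z - (n + (-m : ℤ) * τ)) ^ 2 - 1 / ((n : ℂ) + (-m : ℤ) * τ) ^ 2)
      (-(4 * Real.pi ^ 2) * ∑' w : ℕ+, strandTerm τ z (m, w)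
        - EisensteinSeries.e2Summand (-m) τ) := by
  refine HasSum.sub ?_ ?_
  · simp_rw [strandTerm_eq]
    have him : 0 < (shiftedPoint τ z m).im := by
      have hb := le_im_shiftedPoint (min_le_left z.im (τ.im - z.im)) (min_le_right _ _)
      have hδ : 0 < min z.im (τ.im - z.im) := lt_min h0 (by linarith)
      rcases le_or_gt 0 m with h | h
      · lift m to ℕ using h
        exact lt_of_lt_of_le (by positivity) (hb m).1
      · obtain ⟨n, rfl⟩ : ∃ n : ℕ, m = -((n : ℤ) + 1) := ⟨(-m - 1).toNat, by omega⟩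
        exact lt_of_lt_of_le (by positivity) (hb n).2
    have hs := (summable_inv_add_int_sq (shiftedPoint τ z m)).hasSum
    rw [tsum_inv_add_int_sq him] at hs
    unfold shiftedPoint at hs ⊢
    split_ifs at hs ⊢ with h
    · rw [← (Equiv.neg ℤ).hasSum_iff] at hs
      refine hs.congr_fun fun n => ?_
      simp only [Function.comp, Equiv.neg_apply]
      push_cast
      ring_nf
    · refine hs.congr_fun fun n => ?_
      rw [← neg_sq]
      push_cast
      ring_nf
  -- For m = n = 0 both sides are 0 by the convention for division by zero.
  · refine (EisensteinSeries.e2Summand_summable (-m) τ).hasSum.congr_fun fun n => ?_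
    simp only [EisensteinSeries.eisSummand, Matrix.cons_val_zero, Matrix.cons_val_one]
    rw [zpow_neg, one_div, add_comm]
    norm_cast

/-- The series of ℘ converges unconditionally, so it may be reindexed by ℤ × ℤ and summed by rows.
-/
theorem hasSum_weierstrassP_rows (τ : UpperHalfPlane) {z : ℂ} (h0 : 0 < z.im)
    (h1 : z.im < τ.im) :
    HasSum (fun m : ℤ => -(4 * Real.pi ^ 2) * ∑' w : ℕ+, strandTerm τ z (m, w)
        - EisensteinSeries.e2Summand (-m) τ) ((periodPair τ).weierstrassP z) := by
  have h := (periodPair τ).hasSum_weierstrassP z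
  rw [← (periodPair τ).latticeEquivProd.symm.toEquiv.hasSum_iff,
    ← (Equiv.prodComm ℤ ℤ).hasSum_iff,
    ← (Equiv.prodCongr (Equiv.neg ℤ) (Equiv.refl ℤ)).hasSum_iff] at h
  refine h.prod_fiberwise fun m => ?_
  refine (hasSum_row τ h0 h1 m).congr_fun fun n => ?_
  have := (periodPair τ).latticeEquiv_symm_apply (n, -m)
  simp only [periodPair, mul_one] at this
  simp only [Function.comp, Equiv.prodCongr_apply, Prod.map, Equiv.neg_apply, Equiv.refl_apply,
    Equiv.prodComm_apply, Prod.swap]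
  rw [← this]
  rfl

/-- The known value is that of the symmetric sum over the rows; summability of the rows identifies
it with the unconditional sum. -/
theorem tsum_e2Summand {τ : UpperHalfPlane}
    (h : Summable fun m : ℤ => EisensteinSeries.e2Summand (-m) τ) :
    ∑' m : ℤ, EisensteinSeries.e2Summand (-m) τ
      = Real.pi ^ 2 / 3 * eisensteinE2 (qCoord τ ^ 2) := by
  have h' : Summable fun m : ℤ => EisensteinSeries.e2Summand m τ := by
    rw [← (Equiv.neg ℤ).summable_iff]
    exact h
  rw [show ∑' m : ℤ, EisensteinSeries.e2Summand (-m) τ = ∑' m, EisensteinSeries.e2Summand m τ from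
    (Equiv.neg ℤ).tsum_eq (fun m => EisensteinSeries.e2Summand m τ)]
  have h2 : HasSum (fun m : ℤ => EisensteinSeries.e2Summand m τ)
      (∑' m : ℤ, EisensteinSeries.e2Summand m τ) (SummationFilter.symmetricIcc ℤ) :=
    h'.hasSum.mono_left SummationFilter.LeAtTop.le_atTop
  rw [h2.unique (EisensteinSeries.hasSum_e2Summand_symmetricIcc τ), riemannZeta_two,
    tsum_pnat_eq_tsum_succ (f := fun n : ℕ => (ArithmeticFunction.sigma 1 n : ℂ)
      * Complex.exp (2 * Real.pi * Complex.I * τ) ^ n)]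
  have hq : qCoord τ ^ 2 = Complex.exp (2 * Real.pi * Complex.I * τ) := by
    rw [qCoord, ← Complex.exp_nat_mul]
    congr 1
    push_cast
    ring
  rw [eisensteinE2, hq]
  ring

/-- The expansion of the propagator in the strip `0 < Im z < Im τ`. -/
theorem hasSum_strandTerm (τ : UpperHalfPlane) {z : ℂ} (h0 : 0 < z.im) (h1 : z.im < τ.im) :
    HasSum (strandTerm τ z) (-propagator z τ) := by
  have hs := (summable_norm_strandTerm τ h0 h1).of_norm
  have hpi : (Real.pi : ℂ) ≠ 0 := by exact_mod_cast Real.pi_ne_zero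
  have hrows := hasSum_weierstrassP_rows τ h0 h1
  have hA : Summable fun m : ℤ => -(4 * (Real.pi : ℂ) ^ 2) * ∑' w : ℕ+, strandTerm τ z (m, w) :=
    hs.prod.mul_left _
  -- The Eisenstein rows are the difference of two summable families: the strand rows and the rows
  -- of ℘.
  have hB : Summable fun m : ℤ => EisensteinSeries.e2Summand (-m) τ := by
    refine (hA.sub hrows.summable).congr fun m => ?_
    ring
  have h := hrows.tsum_eq
  rw [hA.tsum_sub hB, tsum_mul_left, ← hs.tsum_prod, tsum_e2Summand hB] at h
  suffices h2 : -propagator z τ = ∑' d, strandTerm τ z d by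
    rw [h2]
    exact hs.hasSum
  unfold propagator
  rw [← h]
  field_simp
  ring

end TropicalMirror

namespace TropicalMirror

/-! ### Termwise integration -/

theorem summable_norm_and_hasSum_prod {m : ℕ} {ι : Type*} {F : Fin m → ι → ℂ} {a : Fin m → ℂ}
    (h : ∀ k, HasSum (F k) (a k)) (hn : ∀ k, Summable fun i => ‖F k i‖) :
    (Summable fun f : Fin m → ι => ‖∏ k, F k (f k)‖) ∧
      HasSum (fun f : Fin m → ι => ∏ k, F k (f k)) (∏ k, a k) := by
  induction m with
  | zero =>
    have := hasSum_unique fun f : Fin 0 → ι => ∏ k, F k (f k)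
    simp only [Fin.prod_univ_zero] at this ⊢
    exact ⟨(hasSum_unique fun f : Fin 0 → ι => ‖(1 : ℂ)‖).summable, this⟩
  | succ m ih =>
    obtain ⟨h1, h2⟩ := ih (F := fun k => F k.succ) (a := fun k => a k.succ) (fun k => h k.succ)
      fun k => hn k.succ
    have h3 : Summable fun x : ι × (Fin m → ι) => ‖F 0 x.1 * ∏ k, F k.succ (x.2 k)‖ := by
      simp_rw [norm_mul]
      exact (hn 0).mul_of_nonneg h1 (fun _ => norm_nonneg _) fun _ => norm_nonneg _
    rw [← (Fin.consEquiv fun _ => ι).summable_iff, ← (Fin.consEquiv fun _ => ι).hasSum_iff,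
      Fin.prod_univ_succ]
    refine ⟨h3.congr fun x => ?_, ((h 0).mul h2 h3.of_norm).congr_fun fun x => ?_⟩
    · simp [Fin.consEquiv, Fin.prod_univ_succ]
    · simp [Fin.consEquiv, Fin.prod_univ_succ]

variable {n m : ℕ}

/-- The net inflow at the vertex `v`. -/
def netFlow (lo hi : Fin m → Fin n) (f : Fin m → ℤ × ℕ+) (v : Fin n) : ℤ :=
  ∑ k, strandSlope (f k) * ((if hi k = v then 1 else 0) - (if lo k = v then 1 else 0))

/-- Flow conservation at all vertices. -/
def IsBalanced (lo hi : Fin m → Fin n) (f : Fin m → ℤ × ℕ+) : Prop :=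
  ∀ v, netFlow lo hi f v = 0

/-- Discrete summation by parts. It collects the exponents of the strands at the vertices, and later
shows that the degree of a cover is constant. -/
theorem sum_netFlow_mul {R : Type*} [CommRing R] (lo hi : Fin m → Fin n) (f : Fin m → ℤ × ℕ+)
    (z : Fin n → R) :
    ∑ v, (netFlow lo hi f v : R) * z v = ∑ k, (strandSlope (f k) : R) * (z (hi k) - z (lo k)) := by
  simp only [netFlow, Int.cast_sum, Finset.sum_mul]
  rw [Finset.sum_comm]
  refine Finset.sum_congr rfl fun k _ => ?_
  push_cast
  simp only [mul_assoc, sub_mul, ← Finset.mul_sum, Finset.sum_sub_distrib, ite_mul, one_mul,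
    zero_mul, Finset.sum_ite_eq, Finset.mem_univ, if_true]

/-- The contribution of a flow to the `q`-expansion. -/
noncomputable def flowCoeff (τ : Fin m → UpperHalfPlane) (f : Fin m → ℤ × ℕ+) : ℂ :=
  (∏ k, ((f k).2 : ℂ)) * qMonomial τ fun k => strandDegree (f k)

theorem prod_strandTerm (τ : Fin m → UpperHalfPlane) (lo hi : Fin m → Fin n)
    (f : Fin m → ℤ × ℕ+) (z : Fin n → ℂ) :
    ∏ k, strandTerm (τ k) (z (hi k) - z (lo k)) (f k)
      = flowCoeff τ f
        * ∏ v, Complex.exp (2 * Real.pi * Complex.I * (netFlow lo hi f v * z v)) := by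
  simp only [strandTerm, flowCoeff, qMonomial, Finset.prod_mul_distrib]
  rw [← Complex.exp_sum, ← Complex.exp_sum, ← Finset.mul_sum, ← Finset.mul_sum, sum_netFlow_mul]

/-- Orthogonality of characters; the height y contributes only a constant factor, which is 1 for b =
0. -/
theorem integral_exp_int (b : ℤ) (y : ℝ) :
    ∫ t in Set.Icc (0 : ℝ) 1, Complex.exp (2 * Real.pi * Complex.I * (b * (Complex.I * y + t)))
      = if b = 0 then 1 else 0 := by
  split_ifs with h
  · simp [h]
  · have hc : 2 * Real.pi * Complex.I * b ≠ 0 := by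
      simp [Real.pi_ne_zero, h]
    have h1 : ∀ t : ℝ, Complex.exp (2 * Real.pi * Complex.I * (b * (Complex.I * y + t)))
        = Complex.exp (2 * Real.pi * Complex.I * (b * (Complex.I * y)))
          * Complex.exp (2 * Real.pi * Complex.I * b * t) := fun t => by
      rw [← Complex.exp_add]
      congr 1
      ring
    simp_rw [h1]
    rw [MeasureTheory.integral_const_mul, MeasureTheory.integral_Icc_eq_integral_Ioc,
      ← intervalIntegral.integral_of_le zero_le_one, integral_exp_mul_complex hc]
    have h2 : Complex.exp (2 * Real.pi * Complex.I * b * (1 : ℝ)) = 1 := by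
      rw [Complex.exp_eq_one_iff]
      exact ⟨b, by push_cast; ring⟩
    rw [h2]
    simp

theorem integral_prod_exp_int (b : Fin n → ℤ) (y : Fin n → ℝ) :
    ∫ t in Set.Icc (0 : Fin n → ℝ) 1,
        ∏ v, Complex.exp (2 * Real.pi * Complex.I * (b v * (Complex.I * y v + t v)))
      = if ∀ v, b v = 0 then 1 else 0 := by
  have hI : Set.Icc (0 : Fin n → ℝ) 1 = Set.univ.pi fun _ => Set.Icc (0 : ℝ) 1 :=
    (Set.pi_univ_Icc _ _).symm
  rw [hI, MeasureTheory.volume_pi, MeasureTheory.Measure.restrict_pi_pi,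
    MeasureTheory.integral_fintype_prod_eq_prod (f := fun v (t : ℝ) =>
      Complex.exp (2 * Real.pi * Complex.I * (b v * (Complex.I * y v + t))))]
  simp_rw [integral_exp_int]
  rw [Finset.prod_ite_zero]
  simp

/-- The integrand for oriented edges. -/
noncomputable def orientedIntegrand (τ : Fin m → UpperHalfPlane) (lo hi : Fin m → Fin n)
    (y t : Fin n → ℝ) : ℂ :=
  ∏ k, -propagator ((Complex.I * y (hi k) + t (hi k)) - (Complex.I * y (lo k) + t (lo k))) (τ k)

variable {τ : Fin m → UpperHalfPlane} {lo hi : Fin m → Fin n} {y : Fin n → ℝ}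

theorem summable_norm_and_hasSum_orientedIntegrand (hpos : ∀ k, y (lo k) < y (hi k))
    (hlt : ∀ k, y (hi k) - y (lo k) < (τ k).im) (t : Fin n → ℝ) :
    (Summable fun f => ‖flowCoeff τ f * ∏ v, Complex.exp
        (2 * Real.pi * Complex.I * (netFlow lo hi f v * (Complex.I * y v + t v)))‖) ∧
      HasSum (fun f => flowCoeff τ f * ∏ v, Complex.exp
        (2 * Real.pi * Complex.I * (netFlow lo hi f v * (Complex.I * y v + t v))))
        (orientedIntegrand τ lo hi y t) := by
  simp_rw [← prod_strandTerm τ lo hi _ fun v => Complex.I * y v + t v]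
  have h0 : ∀ k, 0 < ((Complex.I * y (hi k) + t (hi k))
      - (Complex.I * y (lo k) + t (lo k))).im := fun k => by simp [hpos k]
  have h1 : ∀ k, ((Complex.I * y (hi k) + t (hi k))
      - (Complex.I * y (lo k) + t (lo k))).im < (τ k).im := fun k => by simpa using hlt k
  exact summable_norm_and_hasSum_prod (fun k => hasSum_strandTerm (τ k) (h0 k) (h1 k))
    fun k => summable_norm_strandTerm (τ k) (h0 k) (h1 k)

/-- The real parts t affect only phases, so the norms at t = 0 are one summable majorant for all t.
-/
theorem norm_flowTerm (f : Fin m → ℤ × ℕ+) (t : Fin n → ℝ) :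
    ‖flowCoeff τ f * ∏ v, Complex.exp
        (2 * Real.pi * Complex.I * (netFlow lo hi f v * (Complex.I * y v + t v)))‖
      = ‖flowCoeff τ f * ∏ v, Complex.exp
        (2 * Real.pi * Complex.I * (netFlow lo hi f v * (Complex.I * y v + (0 : Fin n → ℝ) v)))‖ := by
  simp only [norm_mul, norm_prod, Complex.norm_exp]
  simp

/-- Weierstrass M-test applied to the flow series. -/
theorem continuous_orientedIntegrand (hpos : ∀ k, y (lo k) < y (hi k))
    (hlt : ∀ k, y (hi k) - y (lo k) < (τ k).im) :
    Continuous (orientedIntegrand τ lo hi y) := by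
  rw [funext fun t => (summable_norm_and_hasSum_orientedIntegrand hpos hlt t).2.tsum_eq.symm]
  refine continuous_tsum (fun f => by fun_prop)
    (summable_norm_and_hasSum_orientedIntegrand hpos hlt 0).1 fun f t => (norm_flowTerm f t).le

-- Termwise integration is justified by the majorant uniform in t; orthogonality leaves the flows
-- whose net inflow vanishes everywhere.
open Classical in
theorem hasSum_integral_orientedIntegrand (hpos : ∀ k, y (lo k) < y (hi k))
    (hlt : ∀ k, y (hi k) - y (lo k) < (τ k).im) :
    HasSum (fun f => if IsBalanced lo hi f then flowCoeff τ f else 0)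
      (∫ t in Set.Icc (0 : Fin n → ℝ) 1, orientedIntegrand τ lo hi y t) := by
  rw [funext fun t => (summable_norm_and_hasSum_orientedIntegrand hpos hlt t).2.tsum_eq.symm]
  refine (MeasureTheory.hasSum_integral_of_summable_integral_norm
    (μ := MeasureTheory.volume.restrict (Set.Icc (0 : Fin n → ℝ) 1)) (fun f => ?_) ?_).congr_fun
    fun f => ?_
  · exact (Continuous.continuousOn (by fun_prop)).integrableOn_compact isCompact_Icc
  · simp_rw [norm_flowTerm]
    simpa using (summable_norm_and_hasSum_orientedIntegrand hpos hlt 0).1.mul_left _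
  · rw [MeasureTheory.integral_const_mul, integral_prod_exp_int, mul_ite, mul_one,
      mul_zero]
    exact if_congr Iff.rfl rfl rfl

end TropicalMirror

namespace TropicalMirror

/-! ### Flows of given degree -/

variable {n m : ℕ}

/-- The balanced flows with prescribed numbers of preimages of the base point. -/
def flowSet (lo hi : Fin m → Fin n) (a : Fin m → ℕ) : Set (Fin m → ℤ × ℕ+) :=
  {f | IsBalanced lo hi f ∧ ∀ k, strandDegree (f k) = a k}

variable {τ : Fin m → UpperHalfPlane} {lo hi : Fin m → Fin n} {y : Fin n → ℝ}

theorem qMonomial_ne_zero (τ : Fin m → UpperHalfPlane) (a : Fin m → ℕ) : qMonomial τ a ≠ 0 :=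
  Finset.prod_ne_zero_iff.2 fun _ _ => pow_ne_zero _ (Complex.exp_ne_zero _)

theorem flowCoeff_of_mem {a : Fin m → ℕ} {f : Fin m → ℤ × ℕ+} (hf : f ∈ flowSet lo hi a) :
    flowCoeff τ f = (∏ k, ((f k).2 : ℕ) : ℕ) * qMonomial τ a := by
  rw [flowCoeff, funext hf.2]
  push_cast
  rfl

/-- The terms of a convergent series tend to 0 along the cofinite filter, whereas each flow in the
set contributes a term of norm at least ‖q^{2a}‖ > 0, because all weights are at least 1. -/
theorem finite_flowSet_of_start (hpos : ∀ k, y (lo k) < y (hi k))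
    (hlt : ∀ k, y (hi k) - y (lo k) < (τ k).im) (a : Fin m → ℕ) : (flowSet lo hi a).Finite := by
  classical
  have h := (hasSum_integral_orientedIntegrand hpos hlt).summable.norm.tendsto_cofinite_zero
  have hq : 0 < ‖qMonomial τ a‖ := norm_pos_iff.2 (qMonomial_ne_zero τ a)
  have hfin := h.eventually (gt_mem_nhds hq)
  rw [Filter.eventually_cofinite] at hfin
  refine hfin.subset fun f hf => ?_
  have h1 : 1 ≤ ∏ k, ((f k).2 : ℕ) := Finset.one_le_prod' fun k _ => (f k).2.pos
  simp only [Set.mem_ofPred_eq, not_lt, if_pos hf.1, flowCoeff_of_mem hf, norm_mul,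
    Complex.norm_natCast]
  have h2 : (1 : ℝ) ≤ (∏ k, ((f k).2 : ℕ) : ℕ) := by exact_mod_cast h1
  exact le_mul_of_one_le_left hq.le h2

/-- The set does not involve τ, so any τ with large enough imaginary parts will do; here each
exceeds the height difference by 1. -/
theorem finite_flowSet (hpos : ∀ k, y (lo k) < y (hi k)) (a : Fin m → ℕ) :
    (flowSet lo hi a).Finite :=
  finite_flowSet_of_start (y := y) (τ := fun k => ⟨Complex.I * ((y (hi k) - y (lo k) + 1 : ℝ) : ℂ), by
    simpa using by linarith [hpos k]⟩) hpos (fun k => by simp [UpperHalfPlane.im]) a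

theorem hasSum_flowCount (hpos : ∀ k, y (lo k) < y (hi k))
    (hlt : ∀ k, y (hi k) - y (lo k) < (τ k).im) :
    HasSum (fun a => ((∑ᶠ f ∈ flowSet lo hi a, ∏ k, ((f k).2 : ℕ) : ℕ) : ℂ) * qMonomial τ a)
      (∫ t in Set.Icc (0 : Fin n → ℝ) 1, orientedIntegrand τ lo hi y t) := by
  classical
  refine ((hasSum_integral_orientedIntegrand hpos hlt).tsum_fiberwise
    fun f k => strandDegree (f k)).congr_fun fun a => ?_
  have hfin := finite_flowSet hpos a
  rw [tsum_subtype _ fun f => if IsBalanced lo hi f then flowCoeff τ f else 0,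
    tsum_eq_sum (s := hfin.toFinset), finsum_mem_eq_finite_toFinset_sum _ hfin, Nat.cast_sum,
    Finset.sum_mul]
  · refine Finset.sum_congr rfl fun f hf => ?_
    have hf' : f ∈ flowSet lo hi a := by simpa using hf
    rw [Set.indicator_of_mem (by simpa using funext hf'.2), if_pos hf'.1, flowCoeff_of_mem hf']
  · intro f hf
    rw [Set.indicator_apply_eq_zero]
    intro h1
    rw [if_neg]
    intro h2
    refine hf (by simpa using ⟨h2, fun k => congrFun h1 k⟩)

end TropicalMirror

namespace TropicalMirror

/-! ### Points of metric graphs and isomorphisms -/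

namespace TropicalCurve

variable {g : ℕ} (C C' : TropicalCurve g)

theorem edgePoint_start (k : Fin (3 * g - 3)) : C.edgePoint k (C.start k) = C.vertex (C.src k) :=
  Quot.sound (Glue.start k)

theorem edgePoint_finish (k : Fin (3 * g - 3)) :
    C.edgePoint k (C.finish k) = C.vertex (C.tgt k) :=
  Quot.sound (Glue.finish k)

open Classical in
/-- A point of the curve is either a vertex or an interior point of an edge. -/
noncomputable def normalForm : C.Point → Fin (2 * g - 2) ⊕ Fin (3 * g - 3) × ℝ :=
  Quot.lift (Sum.elim Sum.inl fun x =>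
      if (x.2 : ℝ) = 0 then Sum.inl (C.src x.1)
      else if (x.2 : ℝ) = C.len x.1 then Sum.inl (C.tgt x.1) else Sum.inr (x.1, (x.2 : ℝ))) <| by
    rintro _ _ (k | k)
    · simp [start]
    · simp [finish, (C.len_pos k).ne']

theorem normalForm_vertex (v : Fin (2 * g - 2)) : C.normalForm (C.vertex v) = Sum.inl v := rfl

open Classical in
theorem normalForm_edgePoint (k : Fin (3 * g - 3)) (t : Set.Icc (0 : ℝ) (C.len k)) :
    C.normalForm (C.edgePoint k t) = if (t : ℝ) = 0 then Sum.inl (C.src k)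
      else if (t : ℝ) = C.len k then Sum.inl (C.tgt k) else Sum.inr (k, (t : ℝ)) := rfl

/-- `normalForm` respects the gluing, so it separates points of the quotient without a description
of the generated equivalence relation. -/
theorem edgePoint_eq_vertex {k : Fin (3 * g - 3)} {t : Set.Icc (0 : ℝ) (C.len k)}
    {v : Fin (2 * g - 2)} (h : C.edgePoint k t = C.vertex v) :
    (t = C.start k ∧ C.src k = v) ∨ (t = C.finish k ∧ C.tgt k = v) := by
  have := congrArg C.normalForm h
  rw [normalForm_vertex, normalForm_edgePoint] at this
  split_ifs at this with h0 h1
  · exact Or.inl ⟨Subtype.ext h0, Sum.inl_injective this⟩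
  · exact Or.inr ⟨Subtype.ext h1, Sum.inl_injective this⟩

theorem edgePoint_injOn_interior {k : Fin (3 * g - 3)} {t u : Set.Icc (0 : ℝ) (C.len k)}
    (h0 : t ≠ C.start k) (h1 : t ≠ C.finish k) (h : C.edgePoint k t = C.edgePoint k u) :
    t = u := by
  have h2 := congrArg C.normalForm h
  rw [normalForm_edgePoint, normalForm_edgePoint, if_neg fun h : (t : ℝ) = 0 => h0 (Subtype.ext h),
    if_neg fun h : (t : ℝ) = C.len k => h1 (Subtype.ext h)] at h2
  split_ifs at h2
  simpa [Subtype.ext_iff] using h2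

variable {C C'}

/-- The isometry `ι` between the parameter intervals of the edge `k` of two curves is compatible
with the gluing of the ends of the edge to the vertices. -/
structure EdgeMatch (C C' : TropicalCurve g) (k : Fin (3 * g - 3))
    (ι : Set.Icc (0 : ℝ) (C.len k) ≃ᵢ Set.Icc (0 : ℝ) (C'.len k)) : Prop where
  glue_start : C'.edgePoint k (ι (C.start k)) = C'.vertex (C.src k)
  glue_finish : C'.edgePoint k (ι (C.finish k)) = C'.vertex (C.tgt k)

/-- The map of curves that is given by maps of the edges. -/
def pointMap (ι : ∀ k, Set.Icc (0 : ℝ) (C.len k) ≃ᵢ Set.Icc (0 : ℝ) (C'.len k))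
    (h : ∀ k, EdgeMatch C C' k (ι k)) : C.Point → C'.Point :=
  Quot.lift (Sum.elim C'.vertex fun x => C'.edgePoint x.1 (ι x.1 x.2)) <| by
    rintro _ _ (k | k)
    · exact (h k).glue_start
    · exact (h k).glue_finish

theorem continuous_edgePoint (k : Fin (3 * g - 3)) : Continuous (C.edgePoint k) :=
  continuous_quot_mk.comp (continuous_inr.comp continuous_sigmaMk)

theorem continuous_pointMap (ι : ∀ k, Set.Icc (0 : ℝ) (C.len k) ≃ᵢ Set.Icc (0 : ℝ) (C'.len k))
    (h : ∀ k, EdgeMatch C C' k (ι k)) : Continuous (pointMap ι h) := by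
  refine continuous_quot_lift _ (continuous_sum_dom.2 ⟨continuous_of_discreteTopology, ?_⟩)
  exact continuous_sigma fun k => (continuous_edgePoint k).comp (ι k).continuous

/-- Maps of the edges that are compatible with the gluing give a homeomorphism. -/
def pointHomeomorph (ι : ∀ k, Set.Icc (0 : ℝ) (C.len k) ≃ᵢ Set.Icc (0 : ℝ) (C'.len k))
    (h : ∀ k, EdgeMatch C C' k (ι k)) (h' : ∀ k, EdgeMatch C' C k (ι k).symm) :
    C.Point ≃ₜ C'.Point where
  toFun := pointMap ι h
  invFun := pointMap (fun k => (ι k).symm) h'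
  left_inv := by
    rintro ⟨v | ⟨k, t⟩⟩
    · rfl
    · exact congrArg (C.edgePoint k) ((ι k).symm_apply_apply t)
  right_inv := by
    rintro ⟨v | ⟨k, t⟩⟩
    · rfl
    · exact congrArg (C'.edgePoint k) ((ι k).apply_symm_apply t)
  continuous_toFun := continuous_pointMap ι h
  continuous_invFun := continuous_pointMap _ h'

/-- The identification of intervals of equal length. -/
def iccCongr {a b : ℝ} (h : a = b) : Set.Icc (0 : ℝ) a ≃ᵢ Set.Icc (0 : ℝ) b where
  toFun t := ⟨t, t.2.1, t.2.2.trans_eq h⟩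
  invFun t := ⟨t, t.2.1, t.2.2.trans_eq h.symm⟩
  left_inv _ := rfl
  right_inv _ := rfl
  isometry_toFun := Isometry.of_dist_eq fun _ _ => rfl

/-- The identification of intervals of equal length that reverses the direction. -/
def iccReverse {a b : ℝ} (h : a = b) : Set.Icc (0 : ℝ) a ≃ᵢ Set.Icc (0 : ℝ) b where
  toFun t := ⟨b - t, by have := t.2.2; linarith, by have := t.2.1; linarith⟩
  invFun t := ⟨a - t, by have := t.2.2; linarith, by have := t.2.1; linarith⟩
  left_inv t := Subtype.ext (by simp [h])
  right_inv t := Subtype.ext (by simp [h])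
  isometry_toFun := Isometry.of_dist_eq fun t u => by
    rw [Subtype.dist_eq, Subtype.dist_eq, dist_sub_left]

theorem edgeMatch_iccCongr {k : Fin (3 * g - 3)} (h : C.len k = C'.len k)
    (hs : C.src k = C'.src k) (ht : C.tgt k = C'.tgt k) : EdgeMatch C C' k (iccCongr h) where
  glue_start := by
    rw [hs, ← edgePoint_start]
    rfl
  glue_finish := by
    rw [ht, ← edgePoint_finish]
    congr 1
    exact Subtype.ext h

theorem edgeMatch_iccReverse {k : Fin (3 * g - 3)} (h : C.len k = C'.len k)
    (hs : C.src k = C'.tgt k) (ht : C.tgt k = C'.src k) : EdgeMatch C C' k (iccReverse h) where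
  glue_start := by
    rw [hs, ← edgePoint_finish]
    congr 1
    exact Subtype.ext (sub_zero _)
  glue_finish := by
    rw [ht, ← edgePoint_start]
    congr 1
    exact Subtype.ext (by simp [iccReverse, finish, start, h])

end TropicalCurve

/-! ### Isomorphisms of covers and the size of their fibers -/

theorem addCircle_coe_eq_coe {L : ℝ} (a b : ℝ) :
    (a : AddCircle L) = b ↔ ∃ j : ℤ, a = b + j * L := by
  rw [← sub_eq_zero, ← AddCircle.coe_sub, AddCircle.coe_eq_zero_iff]
  refine exists_congr fun j => ?_
  rw [zsmul_eq_mul]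
  constructor <;> intro h <;> linarith

namespace LabeledCover

variable {g : ℕ} {L : ℝ}

open TropicalCurve

theorem map_edgePoint (c : LabeledCover g L) (k : Fin (3 * g - 3))
    (t : Set.Icc (0 : ℝ) (c.curve.len k)) :
    c.map (c.curve.edgePoint k t)
      = c.map (c.curve.vertex (c.curve.src k)) + (((c.slope k : ℝ) * (t : ℝ) : ℝ) : AddCircle L) := by
  rw [c.affine, edgePoint_start]

theorem map_tgt (c : LabeledCover g L) (k : Fin (3 * g - 3)) :
    c.map (c.curve.vertex (c.curve.tgt k)) = c.map (c.curve.vertex (c.curve.src k))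
      + (((c.slope k : ℝ) * c.curve.len k : ℝ) : AddCircle L) := by
  rw [← edgePoint_finish, map_edgePoint]
  rfl

/-- Covers with the same lengths, slopes and images of the vertices are isomorphic. -/
theorem iso_of_eq_or_reverse {c c' : LabeledCover g L}
    (hlen : ∀ k, c.curve.len k = c'.curve.len k)
    (hv : ∀ v, c'.map (c'.curve.vertex v) = c.map (c.curve.vertex v))
    (he : ∀ k, (c.curve.src k = c'.curve.src k ∧ c.curve.tgt k = c'.curve.tgt k
        ∧ c.slope k = c'.slope k) ∨
      (c.curve.src k = c'.curve.tgt k ∧ c.curve.tgt k = c'.curve.src k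
        ∧ c.slope k = -c'.slope k)) : Iso c c' := by
  have key : ∀ k, ∃ ι : Set.Icc (0 : ℝ) (c.curve.len k) ≃ᵢ Set.Icc (0 : ℝ) (c'.curve.len k),
      EdgeMatch c.curve c'.curve k ι ∧ EdgeMatch c'.curve c.curve k ι.symm ∧
      ∀ t, c'.map (c'.curve.edgePoint k (ι t)) = c.map (c.curve.edgePoint k t) := by
    intro k
    rcases he k with ⟨h1, h2, h3⟩ | ⟨h1, h2, h3⟩
    · refine ⟨iccCongr (hlen k), edgeMatch_iccCongr _ h1 h2,
        edgeMatch_iccCongr (hlen k).symm h1.symm h2.symm, fun t => ?_⟩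
      rw [map_edgePoint, map_edgePoint, h1, h3, hv]
      rfl
    · refine ⟨iccReverse (hlen k), edgeMatch_iccReverse _ h1 h2,
        edgeMatch_iccReverse (hlen k).symm h2.symm h1.symm, fun t => ?_⟩
      rw [map_edgePoint, map_edgePoint, h1, h3, ← hv, map_tgt, add_assoc, ← AddCircle.coe_add]
      congr 3
      simp only [iccReverse, IsometryEquiv.coe_mk, Equiv.coe_fn_mk]
      push_cast
      ring
  choose ι h1 h2 h3 using key
  refine ⟨pointHomeomorph ι h1 h2, fun v => rfl, fun k => ⟨ι k, fun t => rfl⟩, ?_⟩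
  rintro ⟨v | ⟨k, t⟩⟩
  · exact hv v
  · exact h3 k t

/-- Vertices go to vertices, so ι maps ends of the interval to ends, and by injectivity not both to
the same one. -/
theorem iso_apply_ends {c c' : LabeledCover g L} {φ : c.curve.Point ≃ₜ c'.curve.Point}
    (hv : ∀ v, φ (c.curve.vertex v) = c'.curve.vertex v) {k : Fin (3 * g - 3)}
    {ι : Set.Icc (0 : ℝ) (c.curve.len k) ≃ᵢ Set.Icc (0 : ℝ) (c'.curve.len k)}
    (hι : ∀ t, φ (c.curve.edgePoint k t) = c'.curve.edgePoint k (ι t)) :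
    (ι (c.curve.start k) = c'.curve.start k ∧ c'.curve.src k = c.curve.src k ∧
      ι (c.curve.finish k) = c'.curve.finish k ∧ c'.curve.tgt k = c.curve.tgt k) ∨
    (ι (c.curve.start k) = c'.curve.finish k ∧ c'.curve.tgt k = c.curve.src k ∧
      ι (c.curve.finish k) = c'.curve.start k ∧ c'.curve.src k = c.curve.tgt k) := by
  have h0 := hι (c.curve.start k)
  have h1 := hι (c.curve.finish k)
  rw [edgePoint_start, hv] at h0
  rw [edgePoint_finish, hv] at h1
  have hne : ι (c.curve.start k) ≠ ι (c.curve.finish k) := fun h =>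
    (c.curve.len_pos k).ne (congrArg Subtype.val (ι.injective h))
  rcases edgePoint_eq_vertex _ h0.symm with ⟨a1, a2⟩ | ⟨a1, a2⟩ <;>
    rcases edgePoint_eq_vertex _ h1.symm with ⟨b1, b2⟩ | ⟨b1, b2⟩
  · exact absurd (a1.trans b1.symm) hne
  · exact Or.inl ⟨a1, a2, b1, b2⟩
  · exact Or.inr ⟨a1, a2, b1, b2⟩
  · exact absurd (a1.trans b1.symm) hne

theorem combType_eq_of_iso {c c' : LabeledCover g L} (h : Iso c c') :
    c.curve.combType = c'.curve.combType := by
  obtain ⟨φ, hv, he, -⟩ := h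
  funext k
  obtain ⟨ι, hι⟩ := he k
  unfold combType
  rcases iso_apply_ends hv hι with ⟨-, h1, -, h2⟩ | ⟨-, h1, -, h2⟩
  · rw [h1, h2]
  · rw [h1, h2, Sym2.eq_swap]

theorem ncard_fiber_eq_of_iso {c c' : LabeledCover g L} (h : Iso c c') (k : Fin (3 * g - 3))
    (x : AddCircle L) : (c.fiber k x).ncard = (c'.fiber k x).ncard := by
  obtain ⟨φ, -, he, hm⟩ := h
  obtain ⟨ι, hι⟩ := he k
  rw [← Set.ncard_image_of_injective _ φ.injective]
  congr 1
  ext P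
  constructor
  · rintro ⟨_, ⟨hx, t, rfl⟩, rfl⟩
    exact ⟨(hm _).trans hx, ι t, (hι t).symm⟩
  · rintro ⟨hx, t, rfl⟩
    have ht : φ (c.curve.edgePoint k (ι.symm t)) = c'.curve.edgePoint k t := by
      rw [hι, ι.apply_symm_apply]
    refine ⟨_, ⟨?_, ι.symm t, rfl⟩, ht⟩
    rw [← hm, ht, hx]

/-- Along an isomorphism that respects the directions of a non-loop edge, the edge keeps its length
and slope. -/
theorem len_slope_eq_of_iso [hL : Fact (0 < L)] {c c' : LabeledCover g L} (h : Iso c c')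
    {k : Fin (3 * g - 3)} (hs : c.curve.src k = c'.curve.src k)
    (hne : c.curve.src k ≠ c.curve.tgt k) :
    c.curve.len k = c'.curve.len k ∧ c.slope k = c'.slope k := by
  obtain ⟨φ, hv, he, hm⟩ := h
  obtain ⟨ι, hι⟩ := he k
  rcases iso_apply_ends hv hι with ⟨h1, -, h3, -⟩ | ⟨-, -, -, h4⟩
  swap
  · exact absurd (hs.trans h4) hne
  -- An isometry that fixes the start preserves the distance to it, which is the parameter.
  have hval : ∀ t, (ι t : ℝ) = t := fun t => by
    have := ι.dist_eq t (c.curve.start k)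
    rw [h1, Subtype.dist_eq, Subtype.dist_eq, Real.dist_eq, Real.dist_eq] at this
    simpa [start, abs_of_nonneg t.2.1, abs_of_nonneg (ι t).2.1] using this
  have hlen : c.curve.len k = c'.curve.len k := by
    have := hval (c.curve.finish k)
    rw [h3] at this
    exact this.symm
  refine ⟨hlen, ?_⟩
  by_contra hslope
  have hL0 : 0 < L := hL.out
  have hd : (0 : ℝ) < |((c.slope k - c'.slope k : ℤ) : ℝ)| :=
    abs_pos.2 (by exact_mod_cast sub_ne_zero.2 hslope)
  set δ : ℝ := ((c.slope k - c'.slope k : ℤ) : ℝ) with hδ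
  -- Chosen so that |δt| ≤ L/2, where the norm on the circle is the absolute value; then δt ≠ 0
  -- survives in the circle.
  let t : Set.Icc (0 : ℝ) (c.curve.len k) := ⟨min (c.curve.len k) (L / (2 * |δ|)),
    le_min (c.curve.len_pos k).le (by positivity), min_le_left _ _⟩
  have ht0 : 0 < (t : ℝ) := lt_min (c.curve.len_pos k) (by positivity)
  have hmap := hm (c.curve.edgePoint k t)
  rw [hι, map_edgePoint, map_edgePoint, hval, ← hs, ← hv, hm, add_right_inj] at hmap
  have hzero : ((δ * t : ℝ) : AddCircle L) = 0 := by
    rw [hδ]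
    push_cast
    rw [sub_mul, AddCircle.coe_sub, hmap, sub_self]
  have hle : |δ * t| ≤ L / 2 := by
    rw [abs_mul, abs_of_pos ht0]
    calc |δ| * t ≤ |δ| * (L / (2 * |δ|)) := by gcongr; exact min_le_right _ _
      _ = L / 2 := by field_simp
  have hn : ‖((δ * t : ℝ) : AddCircle L)‖ = |δ * t| :=
    (AddCircle.norm_coe_eq_abs_iff L hL0.ne').2 (by rwa [abs_of_pos hL0])
  rw [hzero, norm_zero, abs_mul, abs_of_pos ht0] at hn
  exact (mul_pos hd ht0).ne hn

/-- The number of preimages on an edge of a point that is not the image of an end of the edge. -/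
theorem ncard_fiber_mul_weight [hL : Fact (0 < L)] (c : LabeledCover g L) {k : Fin (3 * g - 3)}
    {x ξ : ℝ} (hsrc : c.map (c.curve.vertex (c.curve.src k)) = (x : AddCircle L))
    (hslope : c.slope k ≠ 0) (h0 : c.map (c.curve.vertex (c.curve.src k)) ≠ (ξ : AddCircle L))
    (h1 : c.map (c.curve.vertex (c.curve.tgt k)) ≠ (ξ : AddCircle L)) :
    (((c.fiber k (ξ : AddCircle L)).ncard * c.weight k : ℕ) : ℤ)
      = c.slope k * (⌊(x + c.slope k * c.curve.len k - ξ) / L⌋ - ⌊(x - ξ) / L⌋) := by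
  have hL0 : 0 < L := hL.out
  have hlen := c.curve.len_pos k
  set s : ℤ := c.slope k with hs
  set ℓ : ℝ := c.curve.len k with hℓ
  have hsR : (s : ℝ) ≠ 0 := by exact_mod_cast hslope
  have hmap : ∀ t : Set.Icc (0 : ℝ) ℓ,
      c.map (c.curve.edgePoint k t) = ((x + s * t : ℝ) : AddCircle L) := fun t => by
    rw [map_edgePoint, hsrc, AddCircle.coe_add]
  have h0' : ∀ j : ℤ, (j : ℝ) ≠ (x - ξ) / L := fun j hj => by
    rw [hsrc] at h0
    refine h0 ((addCircle_coe_eq_coe _ _).2 ⟨j, ?_⟩)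
    rw [hj]
    field_simp
    ring
  have h1' : ∀ j : ℤ, (j : ℝ) ≠ (x + s * ℓ - ξ) / L := fun j hj => by
    rw [← edgePoint_finish, hmap] at h1
    refine h1 ((addCircle_coe_eq_coe _ _).2 ⟨j, ?_⟩)
    rw [hj]
    simp only [finish]
    field_simp
    ring
  -- Preimages correspond to the lifts ξ + jL of the point that lie between the lifts x and x + sℓ
  -- of the ends.
  have hcard : ({j : ℤ | (ξ + j * L - x) / s ∈ Set.Icc (0 : ℝ) ℓ}).ncard
      = (c.fiber k (ξ : AddCircle L)).ncard := by
    refine Set.ncard_congr (fun j hj => c.curve.edgePoint k ⟨(ξ + j * L - x) / s, hj⟩) ?_ ?_ ?_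
    · intro j hj
      refine ⟨?_, ⟨_, rfl⟩⟩
      rw [hmap, addCircle_coe_eq_coe]
      refine ⟨j, ?_⟩
      field_simp
      ring
    · intro i j hi hj h
      have h2 := edgePoint_injOn_interior _ ?_ ?_ h
      · have h3 := congrArg Subtype.val h2
        simp only at h3
        field_simp at h3
        have h4 : (i : ℝ) = j := by
          have : (i : ℝ) * L = j * L := by linarith
          exact mul_right_cancel₀ hL0.ne' this
        exact_mod_cast h4
      · intro h2
        have h3 : (ξ + i * L - x) / s = 0 := congrArg Subtype.val h2
        refine h0' i ?_
        field_simp at h3 ⊢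
        linarith
      · intro h2
        have h3 : (ξ + i * L - x) / s = ℓ := congrArg Subtype.val h2
        refine h1' i ?_
        field_simp at h3 ⊢
        linarith
    · rintro _ ⟨hx, t, rfl⟩
      rw [hmap, addCircle_coe_eq_coe] at hx
      obtain ⟨j, hj⟩ := hx
      have ht : (ξ + j * L - x) / s = t := by
        rw [← hj]
        field_simp
        ring
      refine ⟨j, ?_, ?_⟩
      · show (ξ + j * L - x) / s ∈ Set.Icc (0 : ℝ) ℓ
        rw [ht]
        exact t.2
      · congr 1
        exact Subtype.ext ht
  have hIoc : ∀ (a b : ℤ) (A : Set ℤ), a ≤ b → (∀ j, j ∈ A ↔ a < j ∧ j ≤ b) →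
      (A.ncard : ℤ) = b - a := fun a b A hab hA => by
    rw [show A = (Finset.Ioc a b : Set ℤ) by ext j; simp [hA], Set.ncard_coe_finset, Int.card_Ioc,
      Int.toNat_of_nonneg (by omega)]
  rw [← hcard, Nat.cast_mul]
  rcases lt_or_gt_of_ne hslope with hneg | hpos
  · have hsneg : (s : ℝ) < 0 := by exact_mod_cast hneg
    have hprod : s * ℓ < 0 := mul_neg_of_neg_of_pos hsneg hlen
    rw [hIoc ⌊(x + s * ℓ - ξ) / L⌋ ⌊(x - ξ) / L⌋]
    · rw [weight, ← hs, Int.ofNat_natAbs_of_nonpos hneg.le]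
      ring
    · apply Int.floor_mono
      gcongr
      linarith
    · intro j
      rw [Set.mem_ofPred_eq, Int.le_floor, Int.floor_lt, Set.mem_Icc, le_div_iff_of_neg hsneg,
        div_le_iff_of_neg hsneg, zero_mul, le_div_iff₀ hL0, and_comm]
      refine and_congr ?_ (by constructor <;> intro h <;> linarith)
      -- The floors describe a half-open interval and the edge a closed one; they agree since no end
      -- lies over ξ.
      rw [lt_iff_le_and_ne, and_iff_left (h1' j).symm, div_le_iff₀ hL0]
      constructor <;> intro h <;> linarith
  · have hspos : (0 : ℝ) < s := by exact_mod_cast hpos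
    have hprod : 0 < s * ℓ := mul_pos hspos hlen
    rw [hIoc ⌊(x - ξ) / L⌋ ⌊(x + s * ℓ - ξ) / L⌋]
    · rw [weight, ← hs, Int.natAbs_of_nonneg hpos.le]
      ring
    · apply Int.floor_mono
      gcongr
      linarith
    · intro j
      rw [Set.mem_ofPred_eq, Int.le_floor, Int.floor_lt, Set.mem_Icc, le_div_iff₀ hspos,
        div_le_iff₀ hspos, zero_mul, le_div_iff₀ hL0]
      refine and_congr ?_ (by constructor <;> intro h <;> linarith)
      rw [lt_iff_le_and_ne, and_iff_left (h0' j).symm, div_le_iff₀ hL0]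
      constructor <;> intro h <;> linarith

end LabeledCover

end TropicalMirror

namespace TropicalMirror

/-! ### Orientations by a vertex order -/

namespace LabeledGraph

variable {g : ℕ}

/-- The end of the edge `k` that comes first in the order `Ω`. -/
def lowEnd (Γ : LabeledGraph g) (Ω : Equiv.Perm (Fin (2 * g - 2))) (k : Fin (3 * g - 3)) :
    Fin (2 * g - 2) :=
  Ω.symm ((Γ k).map Ω).inf

/-- The end of the edge `k` that comes last in the order `Ω`. -/
def highEnd (Γ : LabeledGraph g) (Ω : Equiv.Perm (Fin (2 * g - 2))) (k : Fin (3 * g - 3)) :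
    Fin (2 * g - 2) :=
  Ω.symm ((Γ k).map Ω).sup

theorem mk_lowEnd_highEnd (Γ : LabeledGraph g) (Ω : Equiv.Perm (Fin (2 * g - 2)))
    (k : Fin (3 * g - 3)) : s(Γ.lowEnd Ω k, Γ.highEnd Ω k) = Γ k := by
  unfold lowEnd highEnd
  induction Γ k with | _ u v
  rcases le_total (Ω u) (Ω v) with h | h
  · simp [h]
  · simp [h]

theorem lowEnd_lt_highEnd {Γ : LabeledGraph g} (hΓ : Γ.Loopless)
    (Ω : Equiv.Perm (Fin (2 * g - 2))) (k : Fin (3 * g - 3)) :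
    Ω (Γ.lowEnd Ω k) < Ω (Γ.highEnd Ω k) := by
  refine lt_of_le_of_ne ?_ fun h => hΓ k ?_
  · simpa [lowEnd, highEnd] using Sym2.inf_le_sup _
  · rw [← Γ.mk_lowEnd_highEnd Ω k, Sym2.mk_isDiag_iff]
    exact Ω.injective h

end LabeledGraph

theorem integrand_eq_orientedIntegrand {g : ℕ} (Γ : LabeledGraph g)
    (τ : Fin (3 * g - 3) → UpperHalfPlane) (Ω : Equiv.Perm (Fin (2 * g - 2)))
    (y t : Fin (2 * g - 2) → ℝ) :
    integrand Γ τ y t = orientedIntegrand τ (Γ.lowEnd Ω) (Γ.highEnd Ω) y t := by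
  refine Finset.prod_congr rfl fun k _ => ?_
  rw [← Γ.mk_lowEnd_highEnd Ω k, ← propagator_neg, neg_sub]
  rfl

/-! ### Covers and flows -/

theorem strandSlope_ne_zero (d : ℤ × ℕ+) : strandSlope d ≠ 0 := by
  have := d.2.pos
  unfold strandSlope
  split_ifs <;> omega

theorem natAbs_strandSlope (d : ℤ × ℕ+) : (strandSlope d).natAbs = d.2 := by
  unfold strandSlope
  split_ifs <;> simp

theorem strandSlope_mul (d : ℤ × ℕ+) : strandSlope d * d.1 = strandDegree d := by
  unfold strandSlope strandDegree
  push_cast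
  split_ifs with h
  · rw [abs_of_nonneg h]
  · rw [abs_of_neg (not_le.1 h)]
    ring

/-- D + nL is positive exactly for n ≥ 0, which is why the sign convention of `strandSlope` counts 0
as positive. -/
theorem div_strandSlope_pos {L D : ℝ} (h0 : 0 < D) (h1 : D < L) (d : ℤ × ℕ+) :
    0 < (D + d.1 * L) / strandSlope d := by
  have hw : (0 : ℝ) < (d.2 : ℕ) := by exact_mod_cast d.2.pos
  unfold strandSlope
  split_ifs with h
  · have h2 : (0 : ℝ) ≤ d.1 := by exact_mod_cast h
    push_cast
    have : 0 ≤ d.1 * L := mul_nonneg h2 (by linarith)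
    positivity
  · have h2 : (d.1 : ℝ) ≤ -1 := by exact_mod_cast (by omega : d.1 ≤ -1)
    push_cast
    refine div_pos_of_neg_of_neg ?_ (by linarith)
    nlinarith

/-- A real number in `(0, L) + n L` that is a positive multiple of the nonzero integer `s` comes
from a strand of slope `s` with winding number `n`. -/
theorem strandSlope_mk {L D ℓ : ℝ} {s n : ℤ} (h0 : 0 < D) (h1 : D < L) (hℓ : 0 < ℓ)
    (h : s * ℓ = D + n * L) (hs : 0 < s.natAbs) : strandSlope (n, ⟨s.natAbs, hs⟩) = s := by
  have hL : 0 < L := h0.trans h1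
  unfold strandSlope
  simp only [PNat.mk_coe]
  split_ifs with hn
  · have h2 : (0 : ℝ) ≤ n := by exact_mod_cast hn
    have h3 : (0 : ℝ) < s := by
      refine pos_of_mul_pos_left (b := ℓ) ?_ hℓ.le
      rw [h]
      have := mul_nonneg h2 hL.le
      linarith
    exact Int.natAbs_of_nonneg (by exact_mod_cast h3.le)
  · have h2 : (n : ℝ) ≤ -1 := by exact_mod_cast (by omega : n ≤ -1)
    have h3 : (s : ℝ) < 0 := by
      by_contra h4
      have := mul_nonneg (not_lt.1 h4) hℓ.le
      rw [h] at this
      nlinarith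
    have h4 : s < 0 := by exact_mod_cast h3
    omega

/-- The difference of the two weight sums is the sum of all signed outgoing slopes; the two rays of
a loop cancel. -/
theorem sum_ray_natAbs_eq_iff {g : ℕ} (C : TropicalCurve g) (s : Fin (3 * g - 3) → ℤ)
    (v : Fin (2 * g - 2)) :
    (∑ r with C.rayVertex r = v ∧ 0 < raySlope s r, (raySlope s r).natAbs
      = ∑ r with C.rayVertex r = v ∧ raySlope s r < 0, (raySlope s r).natAbs) ↔
    ∑ k, s k * ((if C.tgt k = v then 1 else 0) - (if C.src k = v then 1 else 0)) = 0 := by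
  have key : ((∑ r with C.rayVertex r = v ∧ 0 < raySlope s r, (raySlope s r).natAbs : ℕ) : ℤ)
      - (∑ r with C.rayVertex r = v ∧ raySlope s r < 0, (raySlope s r).natAbs : ℕ)
      = - ∑ k, s k * ((if C.tgt k = v then 1 else 0) - (if C.src k = v then 1 else 0)) := by
    rw [Finset.sum_filter, Finset.sum_filter, Nat.cast_sum, Nat.cast_sum, ← Finset.sum_sub_distrib,
      Fintype.sum_prod_type, ← Finset.sum_neg_distrib]
    refine Finset.sum_congr rfl fun k _ => ?_
    simp only [Fintype.sum_bool, TropicalCurve.rayVertex, raySlope]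
    rcases lt_trichotomy (s k) 0 with h | h | h <;>
      by_cases h1 : C.tgt k = v <;> by_cases h2 : C.src k = v <;>
      simp [h1, h2, h, h.le, abs_of_neg, abs_of_pos, not_lt.2]
  omega

end TropicalMirror

/-! ### Cutting the elliptic curve at the base point -/

namespace TropicalMirror

/-- The lifts `X i` of the points `p i`, in increasing order, to the fundamental domain that starts
at the lift `b` of the base point. -/
structure IsSortedLift {N : ℕ} {L : ℝ} (p₀ : AddCircle L) (p : Fin N → AddCircle L) (b : ℝ)
    (X : Fin N → ℝ) : Prop where
  strictMono : StrictMono X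
  mem : ∀ i, X i ∈ Set.Ioo b (b + L)
  base : (b : AddCircle L) = p₀
  range : Set.range (fun i => (X i : AddCircle L)) = Set.range p

theorem exists_isSortedLift {N : ℕ} {L : ℝ} [hL : Fact (0 < L)] {p₀ : AddCircle L}
    {p : Fin N → AddCircle L} (hp : Function.Injective p) (hp₀ : p₀ ∉ Set.range p) :
    ∃ b X, IsSortedLift p₀ p b X := by
  obtain ⟨b, rfl⟩ := QuotientAddGroup.mk_surjective p₀
  let q : Fin N → ℝ := fun i => AddCircle.equivIco L b (p i)
  have hq : ∀ i, (q i : AddCircle L) = p i := fun i => AddCircle.coe_equivIco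
  have hinj : Function.Injective q := fun i j h => hp (by rw [← hq i, ← hq j, h])
  have hcard : (Finset.univ.image q).card = N := by
    rw [Finset.card_image_of_injective _ hinj, Finset.card_univ, Fintype.card_fin]
  have hrange : Set.range ((Finset.univ.image q).orderEmbOfFin hcard) = Set.range q := by
    rw [Finset.range_orderEmbOfFin]
    simp
  refine ⟨b, (Finset.univ.image q).orderEmbOfFin hcard, OrderEmbedding.strictMono _, fun i => ?_,
    rfl, ?_⟩
  · obtain ⟨j, hj⟩ : (Finset.univ.image q).orderEmbOfFin hcard i ∈ Set.range q :=
      hrange ▸ Set.mem_range_self i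
    rw [← hj]
    -- A lift equal to b would make the base point a branch point.
    refine ⟨lt_of_le_of_ne (AddCircle.equivIco L b (p j)).2.1 fun h => hp₀ ⟨j, ?_⟩,
      (AddCircle.equivIco L b (p j)).2.2⟩
    rw [← hq j]
    exact congrArg _ h.symm
  · rw [show (fun i => ((Finset.univ.image q).orderEmbOfFin hcard i : AddCircle L))
      = (fun x : ℝ => (x : AddCircle L)) ∘ (Finset.univ.image q).orderEmbOfFin hcard from rfl,
      Set.range_comp, hrange, ← Set.range_comp]
    exact congrArg Set.range (funext hq)

namespace IsSortedLift

variable {N : ℕ} {L : ℝ} {p₀ : AddCircle L} {p : Fin N → AddCircle L} {b : ℝ} {X : Fin N → ℝ}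

theorem sub_pos (h : IsSortedLift p₀ p b X) {i j : Fin N} (hij : i < j) : 0 < X j - X i :=
  _root_.sub_pos.2 (h.strictMono hij)

theorem sub_lt (h : IsSortedLift p₀ p b X) (i j : Fin N) : X j - X i < L := by
  have h1 := (h.mem j).2
  have h2 := (h.mem i).1
  linarith

variable [hL : Fact (0 < L)]

theorem coe_ne_coe (h : IsSortedLift p₀ p b X) {i : Fin N} {ξ : ℝ} (hξ : ξ ∈ Set.Ico b (b + L))
    (hne : X i ≠ ξ) : (X i : AddCircle L) ≠ ξ := fun he =>
  hne ((AddCircle.coe_eq_coe_iff_of_mem_Ico (Set.Ioo_subset_Ico_self (h.mem i)) hξ).1 he)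

theorem coe_injective (h : IsSortedLift p₀ p b X) :
    Function.Injective fun i => (X i : AddCircle L) := fun i j hij => by
  by_contra hne
  exact h.coe_ne_coe (Set.Ioo_subset_Ico_self (h.mem j)) (h.strictMono.injective.ne hne) hij

/-- X i and ξ lie in one fundamental domain, so their difference is strictly between -L and L. -/
theorem floor_sub_div (h : IsSortedLift p₀ p b X) (i : Fin N) {ξ : ℝ}
    (hξ : ξ ∈ Set.Ico b (b + L)) (n : ℤ) :
    ⌊(X i + n * L - ξ) / L⌋ = n + if X i < ξ then -1 else 0 := by
  have hL0 : 0 < L := hL.out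
  obtain ⟨h1, h2⟩ := h.mem i
  obtain ⟨h3, h4⟩ := hξ
  rw [Int.floor_eq_iff, le_div_iff₀ hL0, div_lt_iff₀ hL0]
  split_ifs with hlt
  · push_cast
    constructor <;> linarith
  · push_cast
    constructor <;> linarith

end IsSortedLift

/-! ### The cover attached to a vertex order and a balanced flow -/

variable {g : ℕ} {L : ℝ} {p₀ : AddCircle L} {p : Fin (2 * g - 2) → AddCircle L} {b : ℝ}
  {X : Fin (2 * g - 2) → ℝ} {Γ : LabeledGraph g}

open LabeledGraph

/-- The length of an edge that carries a given strand. -/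
noncomputable def strandLength (L : ℝ) (X : Fin (2 * g - 2) → ℝ) (Γ : LabeledGraph g)
    (Ω : Equiv.Perm (Fin (2 * g - 2))) (f : Fin (3 * g - 3) → ℤ × ℕ+) (k : Fin (3 * g - 3)) : ℝ :=
  (X (Ω (Γ.highEnd Ω k)) - X (Ω (Γ.lowEnd Ω k)) + (f k).1 * L) / strandSlope (f k)

theorem strandSlope_mul_strandLength (Ω : Equiv.Perm (Fin (2 * g - 2)))
    (f : Fin (3 * g - 3) → ℤ × ℕ+) (k : Fin (3 * g - 3)) :
    strandSlope (f k) * strandLength L X Γ Ω f k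
      = X (Ω (Γ.highEnd Ω k)) - X (Ω (Γ.lowEnd Ω k)) + (f k).1 * L :=
  mul_div_cancel₀ _ (by exact_mod_cast strandSlope_ne_zero (f k))

/-- The metric graph on which a flow lives. -/
noncomputable def flowCurve (h : IsSortedLift p₀ p b X) (hΓ : IsFeynman Γ) (hl : Loopless Γ)
    (Ω : Equiv.Perm (Fin (2 * g - 2))) (f : Fin (3 * g - 3) → ℤ × ℕ+) : TropicalCurve g where
  src := Γ.lowEnd Ω
  tgt := Γ.highEnd Ω
  len := strandLength L X Γ Ω f
  len_pos k := div_strandSlope_pos (h.sub_pos (lowEnd_lt_highEnd hl Ω k)) (h.sub_lt _ _) (f k)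
  isFeynman := by
    rw [funext (Γ.mk_lowEnd_highEnd Ω)]
    exact hΓ

/-- The map of the metric graph of a flow to the elliptic curve. -/
noncomputable def flowMap (h : IsSortedLift p₀ p b X) (hΓ : IsFeynman Γ) (hl : Loopless Γ)
    (Ω : Equiv.Perm (Fin (2 * g - 2))) (f : Fin (3 * g - 3) → ℤ × ℕ+) :
    (flowCurve h hΓ hl Ω f).Point → AddCircle L :=
  Quot.lift (Sum.elim (fun v => (X (Ω v) : AddCircle L)) fun x =>
      ((X (Ω (Γ.lowEnd Ω x.1)) + strandSlope (f x.1) * (x.2 : ℝ) : ℝ) : AddCircle L)) <| by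
    rintro _ _ (k | k)
    · simp [TropicalCurve.start, flowCurve]
    · simp only [Sum.elim_inr, Sum.elim_inl, TropicalCurve.finish]
      rw [addCircle_coe_eq_coe]
      refine ⟨(f k).1, ?_⟩
      show X _ + _ * strandLength L X Γ Ω f k = X (Ω (Γ.highEnd Ω k)) + _
      rw [strandSlope_mul_strandLength]
      ring

variable [hL : Fact (0 < L)]

/-- The cover that is given by an order of the vertices and a balanced flow. -/
noncomputable def flowCover (hg : 1 < g) (h : IsSortedLift p₀ p b X) (hΓ : IsFeynman Γ)
    (hl : Loopless Γ) (Ω : Equiv.Perm (Fin (2 * g - 2))) (f : Fin (3 * g - 3) → ℤ × ℕ+)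
    (hf : IsBalanced (Γ.lowEnd Ω) (Γ.highEnd Ω) f) : LabeledCover g L where
  curve := flowCurve h hΓ hl Ω f
  map := flowMap h hΓ hl Ω f
  continuous_map := by
    refine continuous_quot_lift _ (continuous_sum_dom.2 ⟨continuous_of_discreteTopology, ?_⟩)
    refine continuous_sigma fun k => (AddCircle.continuous_mk' L).comp ?_
    fun_prop
  nonconstant := by
    -- For g > 1 there are at least two vertices, and distinct vertices have distinct images.
    refine ⟨(flowCurve h hΓ hl Ω f).vertex ⟨0, by omega⟩,
      (flowCurve h hΓ hl Ω f).vertex ⟨1, by omega⟩, fun he => ?_⟩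
    have := Ω.injective (h.coe_injective he)
    simp at this
  slope k := strandSlope (f k)
  affine k t := by
    show ((X (Ω (Γ.lowEnd Ω k)) + strandSlope (f k) * (t : ℝ) : ℝ) : AddCircle L)
      = ((X (Ω (Γ.lowEnd Ω k)) + strandSlope (f k) * (0 : ℝ) : ℝ) : AddCircle L) + _
    rw [mul_zero, add_zero, AddCircle.coe_add]
  balanced v := (sum_ray_natAbs_eq_iff _ _ v).2 (hf v)

section flowCover

variable (hg : 1 < g) (h : IsSortedLift p₀ p b X) (hΓ : IsFeynman Γ) (hl : Loopless Γ)
  (Ω : Equiv.Perm (Fin (2 * g - 2))) (f : Fin (3 * g - 3) → ℤ × ℕ+)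
  (hf : IsBalanced (Γ.lowEnd Ω) (Γ.highEnd Ω) f)

theorem flowCover_map_vertex (v : Fin (2 * g - 2)) :
    (flowCover hg h hΓ hl Ω f hf).map ((flowCover hg h hΓ hl Ω f hf).curve.vertex v)
      = (X (Ω v) : AddCircle L) := rfl

theorem flowCover_combType : (flowCover hg h hΓ hl Ω f hf).curve.combType = Γ :=
  funext (Γ.mk_lowEnd_highEnd Ω)

theorem flowCover_weight (k : Fin (3 * g - 3)) :
    (flowCover hg h hΓ hl Ω f hf).weight k = (f k).2 := natAbs_strandSlope (f k)

/-- The correction to `strandDegree` is the slope times the difference of a vertex function at the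
two ends of the edge, so it sums to zero over a balanced flow. -/
theorem flowCover_ncard_fiber (k : Fin (3 * g - 3)) {ξ : ℝ} (hξ : ξ ∈ Set.Ico b (b + L))
    (hne : ∀ i, X i ≠ ξ) :
    ((((flowCover hg h hΓ hl Ω f hf).fiber k (ξ : AddCircle L)).ncard
        * (flowCover hg h hΓ hl Ω f hf).weight k : ℕ) : ℤ)
      = strandDegree (f k) + strandSlope (f k) * ((if X (Ω (Γ.highEnd Ω k)) < ξ then -1 else 0)
          - (if X (Ω (Γ.lowEnd Ω k)) < ξ then -1 else 0)) := by
  have key := (flowCover hg h hΓ hl Ω f hf).ncard_fiber_mul_weight (k := k)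
    (x := X (Ω (Γ.lowEnd Ω k))) (ξ := ξ) rfl (strandSlope_ne_zero (f k))
    (h.coe_ne_coe hξ (hne _)) (h.coe_ne_coe hξ (hne _))
  rw [key]
  show strandSlope (f k) * (⌊(X (Ω (Γ.lowEnd Ω k))
    + strandSlope (f k) * strandLength L X Γ Ω f k - ξ) / L⌋ - _) = _
  have h0 := h.floor_sub_div (Ω (Γ.lowEnd Ω k)) hξ 0
  rw [Int.cast_zero, zero_mul, add_zero, zero_add] at h0
  rw [strandSlope_mul_strandLength, h0, ← add_assoc, add_sub_cancel, h.floor_sub_div _ hξ,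
    ← strandSlope_mul]
  ring

theorem flowCover_hasDegree :
    (flowCover hg h hΓ hl Ω f hf).HasDegree (∑ k, strandDegree (f k)) := by
  intro x hx
  obtain ⟨ξ, hξ, rfl⟩ : ∃ ξ ∈ Set.Ico b (b + L), (ξ : AddCircle L) = x :=
    ⟨_, (AddCircle.equivIco L b x).2, AddCircle.coe_equivIco⟩
  have hne : ∀ i, X i ≠ ξ := fun i hi => hx (Ω.symm i) (by
    rw [flowCover_map_vertex, Ω.apply_symm_apply, hi])
  zify
  have hk := flowCover_ncard_fiber hg h hΓ hl Ω f hf (hξ := hξ) (hne := hne)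
  push_cast at hk
  simp_rw [hk]
  rw [Finset.sum_add_distrib]
  -- Summation by parts turns the total correction into net inflows, all of which vanish.
  have hz := sum_netFlow_mul (R := ℤ) (Γ.lowEnd Ω) (Γ.highEnd Ω) f
    fun v => if X (Ω v) < ξ then -1 else 0
  simp only [Int.cast_id, hf _, zero_mul, Finset.sum_const_zero] at hz
  rw [← hz, add_zero]

theorem flowCover_branchType (k : Fin (3 * g - 3)) :
    ((flowCover hg h hΓ hl Ω f hf).fiber k p₀).ncard * (flowCover hg h hΓ hl Ω f hf).weight k
      = strandDegree (f k) := by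
  have hL0 : 0 < L := hL.out
  -- Over the base point ξ = b no vertex lies to the left, so both corrections vanish.
  have hlt : ∀ i, ¬ X i < b := fun i => not_lt.2 (h.mem i).1.le
  have := flowCover_ncard_fiber hg h hΓ hl Ω f hf k (ξ := b) ⟨le_rfl, by linarith⟩
    fun i => (h.mem i).1.ne'
  rw [h.base] at this
  simp only [hlt, if_false, sub_self, mul_zero, add_zero] at this
  exact_mod_cast this

theorem flowCover_hasBranchType {a : Fin (3 * g - 3) → ℕ} (ha : ∀ k, strandDegree (f k) = a k) :
    (flowCover hg h hΓ hl Ω f hf).HasBranchType p₀ p a where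
  branchPoints := by
    rw [← h.range]
    exact Ω.surjective.range_comp fun i => (X i : AddCircle L)
  degree := by
    simp_rw [← ha]
    exact flowCover_hasDegree hg h hΓ hl Ω f hf
  branchType k := by rw [flowCover_branchType, ha]

end flowCover

/-- Isomorphic covers of flows come from the same order and the same flow. -/
theorem flowCover_injective (hg : 1 < g) (h : IsSortedLift p₀ p b X) (hΓ : IsFeynman Γ)
    (hl : Loopless Γ) {Ω Ω' : Equiv.Perm (Fin (2 * g - 2))} {f f' : Fin (3 * g - 3) → ℤ × ℕ+}
    (hf : IsBalanced (Γ.lowEnd Ω) (Γ.highEnd Ω) f)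
    (hf' : IsBalanced (Γ.lowEnd Ω') (Γ.highEnd Ω') f')
    (hiso : LabeledCover.Iso (flowCover hg h hΓ hl Ω f hf) (flowCover hg h hΓ hl Ω' f' hf')) :
    Ω = Ω' ∧ f = f' := by
  have hΩ : Ω = Ω' := by
    obtain ⟨φ, hv, -, hm⟩ := hiso
    refine Equiv.ext fun v => h.coe_injective ?_
    have := hm ((flowCover hg h hΓ hl Ω f hf).curve.vertex v)
    rw [hv] at this
    exact this.symm
  subst hΩ
  refine ⟨rfl, funext fun k => ?_⟩
  have hne : Γ.lowEnd Ω k ≠ Γ.highEnd Ω k := fun he =>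
    (lowEnd_lt_highEnd hl Ω k).ne (congrArg Ω he)
  obtain ⟨hlen, hslope⟩ := LabeledCover.len_slope_eq_of_iso hiso (k := k) rfl hne
  change strandLength L X Γ Ω f k = strandLength L X Γ Ω f' k at hlen
  change strandSlope (f k) = strandSlope (f' k) at hslope
  -- Slope times length is D + nL with the same D for both flows, so it recovers the winding number.
  have h1 := strandSlope_mul_strandLength (L := L) (X := X) (Γ := Γ) Ω f k
  rw [hslope, hlen, strandSlope_mul_strandLength] at h1
  refine Prod.ext ?_ (PNat.eq ?_)
  · have h2 := mul_right_cancel₀ hL.out.ne' (add_left_cancel h1)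
    exact_mod_cast h2.symm
  · rw [← natAbs_strandSlope, hslope, natAbs_strandSlope]

end TropicalMirror

namespace TropicalMirror

open LabeledGraph

/-! ### Every cover comes from a flow -/

theorem classes_eq_biUnion {g : ℕ} {L : ℝ} (p₀ : AddCircle L) (p : Fin (2 * g - 2) → AddCircle L)
    (S : Set (LabeledGraph g)) (a : Fin (3 * g - 3) → ℕ) :
    LabeledCover.classes p₀ p S a = ⋃ Γ ∈ S, LabeledCover.classes p₀ p {Γ} a := by
  ext x
  simp only [Set.mem_iUnion]
  constructor
  · rintro ⟨c, hx, hS, hc⟩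
    exact ⟨_, hS, c, hx, rfl, hc⟩
  · rintro ⟨Γ, hS, c, hx, rfl, hc⟩
    exact ⟨c, hx, hS, hc⟩

/-- A cover whose vertices have different images has no loops: at a loop, the third edge would have
slope zero, hence be a loop as well. -/
theorem loopless_of_injective {g : ℕ} {L : ℝ} {c : LabeledCover g L}
    (hc : Function.Injective fun v => c.map (c.curve.vertex v)) : Loopless c.curve.combType := by
  have hdiag : ∀ k, c.slope k = 0 → c.curve.src k = c.curve.tgt k := fun k hk => by
    refine hc ?_
    show c.map _ = c.map _
    rw [c.map_tgt, hk]
    simp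
  intro k₀ hk₀
  have hloop : c.curve.src k₀ = c.curve.tgt k₀ := hk₀
  set v := c.curve.src k₀ with hv
  have hcount : ∀ k, (c.curve.combType k).toMultiset.count v
      = (if c.curve.src k = v then 1 else 0) + (if c.curve.tgt k = v then 1 else 0) := fun k => by
    show (s(c.curve.src k, c.curve.tgt k)).toMultiset.count v = _
    rw [show (s(c.curve.src k, c.curve.tgt k)).toMultiset = {c.curve.src k, c.curve.tgt k} from rfl]
    simp only [Multiset.insert_eq_cons, Multiset.count_cons, Multiset.count_singleton, eq_comm]
    ring
  have hval : ∑ k, ((if c.curve.src k = v then 1 else 0) + (if c.curve.tgt k = v then 1 else 0))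
      = 3 :=
    (Finset.sum_congr rfl fun k _ => (hcount k).symm).trans (c.curve.isFeynman.trivalent v)
  have hnet := (sum_ray_natAbs_eq_iff c.curve c.slope v).1 (c.balanced v)
  rw [← Finset.add_sum_erase _ _ (Finset.mem_univ k₀)] at hval hnet
  rw [if_pos hv.symm, if_pos hloop.symm] at hval hnet
  -- The loop uses two of the three ends at v; k₁ carries the third, and balancing at v then forces
  -- its slope to be 0.
  obtain ⟨k₁, hk₁, hone⟩ : ∃ k₁ ∈ Finset.univ.erase k₀,
      (if c.curve.src k₁ = v then 1 else 0) + (if c.curve.tgt k₁ = v then 1 else 0) ≠ 0 := by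
    by_contra! hcon
    rw [Finset.sum_eq_zero hcon] at hval
    omega
  rw [← Finset.add_sum_erase _ _ hk₁] at hval hnet
  have hrest : ∀ k ∈ (Finset.univ.erase k₀).erase k₁,
      (if c.curve.src k = v then 1 else 0) + (if c.curve.tgt k = v then 1 else 0) = 0 := by
    refine Finset.sum_eq_zero_iff.1 ?_
    omega
  rw [Finset.sum_eq_zero (s := (Finset.univ.erase k₀).erase k₁) fun k hk => ?_] at hnet
  · have hd := hdiag k₁
    by_cases h1 : c.curve.src k₁ = v <;> by_cases h2 : c.curve.tgt k₁ = v
    · simp only [h1, h2, if_true] at hval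
      omega
    · simp only [h1, h2, if_true, if_false] at hnet
      exact h2 (by rw [← hd (by omega), h1])
    · simp only [h1, h2, if_true, if_false] at hnet
      exact h1 (by rw [hd (by omega), h2])
    · simp [h1, h2] at hone
  · have := hrest k hk
    by_cases h1 : c.curve.src k = v <;> by_cases h2 : c.curve.tgt k = v <;> simp_all

variable {g : ℕ} {L : ℝ} [hL : Fact (0 < L)] {p₀ : AddCircle L}
  {p : Fin (2 * g - 2) → AddCircle L} {b : ℝ} {X : Fin (2 * g - 2) → ℝ} {Γ : LabeledGraph g}

/-- There are as many vertices as branch points, so hitting every branch point already makes the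
assignment bijective. -/
theorem IsSortedLift.exists_perm (h : IsSortedLift p₀ p b X) {c : LabeledCover g L}
    (hc : Set.range (fun v => c.map (c.curve.vertex v)) = Set.range p) :
    ∃ Ω : Equiv.Perm (Fin (2 * g - 2)), ∀ v, c.map (c.curve.vertex v) = (X (Ω v) : AddCircle L) := by
  rw [← h.range] at hc
  have h1 : ∀ v, ∃ i, (X i : AddCircle L) = c.map (c.curve.vertex v) := fun v =>
    hc.subset ⟨v, rfl⟩
  choose ω hω using h1
  have hsurj : Function.Surjective ω := fun i => by
    obtain ⟨v, hv⟩ := hc.superset ⟨i, rfl⟩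
    exact ⟨v, h.coe_injective ((hω v).trans hv)⟩
  exact ⟨Equiv.ofBijective ω (Finite.injective_iff_bijective.1 (Finite.injective_iff_surjective.2
    hsurj)), fun v => (hω v).symm⟩

/-- Every cover with the given branch points is isomorphic to the cover of a flow. -/
theorem exists_iso_flowCover (hg : 1 < g) (h : IsSortedLift p₀ p b X) (hΓ : IsFeynman Γ)
    (hl : Loopless Γ) {c : LabeledCover g L} (hc : c.curve.combType = Γ)
    (hbr : Set.range (fun v => c.map (c.curve.vertex v)) = Set.range p) :
    ∃ Ω f hf, LabeledCover.Iso c (flowCover hg h hΓ hl Ω f hf) := by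
  obtain ⟨Ω, hΩ⟩ := h.exists_perm hbr
  have hedge : ∀ k, s(c.curve.src k, c.curve.tgt k) = s(Γ.lowEnd Ω k, Γ.highEnd Ω k) := fun k => by
    rw [Γ.mk_lowEnd_highEnd Ω k, ← hc]
    rfl
  have key : ∀ k, ∃ d : ℤ × ℕ+,
      strandSlope d * c.curve.len k
        = X (Ω (Γ.highEnd Ω k)) - X (Ω (Γ.lowEnd Ω k)) + d.1 * L ∧
      ((c.curve.src k = Γ.lowEnd Ω k ∧ c.curve.tgt k = Γ.highEnd Ω k
        ∧ c.slope k = strandSlope d) ∨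
      (c.curve.src k = Γ.highEnd Ω k ∧ c.curve.tgt k = Γ.lowEnd Ω k
        ∧ c.slope k = -strandSlope d)) := by
    intro k
    have h0 := h.sub_pos (lowEnd_lt_highEnd hl Ω k)
    have h1 := h.sub_lt (Ω (Γ.lowEnd Ω k)) (Ω (Γ.highEnd Ω k))
    have htgt := c.map_tgt k
    rw [hΩ, hΩ, ← AddCircle.coe_add, addCircle_coe_eq_coe] at htgt
    obtain ⟨j, hj⟩ := htgt
    have hstrand : ∀ s n : ℤ, (s : ℝ) * c.curve.len k
        = X (Ω (Γ.highEnd Ω k)) - X (Ω (Γ.lowEnd Ω k)) + n * L →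
        ∃ w : ℕ+, strandSlope (n, w) = s := by
      intro s n hsn
      -- Slope 0 would make D, which lies strictly between 0 and L, a multiple of L.
      have hs : 0 < s.natAbs := by
        rw [Int.natAbs_pos]
        rintro rfl
        rw [Int.cast_zero, zero_mul] at hsn
        have hn0 : (n : ℝ) < 0 := by
          by_contra hn
          have := mul_nonneg (not_lt.1 hn) hL.out.le
          linarith
        have hn1 : (n : ℝ) ≤ -1 := by
          exact_mod_cast Int.le_sub_one_of_lt (by exact_mod_cast hn0 : n < 0)
        have hL0 : 0 < L := hL.out
        nlinarith
      exact ⟨⟨s.natAbs, hs⟩, strandSlope_mk h0 h1 (c.curve.len_pos k) hsn hs⟩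
    -- The edge may be parametrized along or against the orientation by Ω; in the second case slope
    -- and winding number change sign.
    rcases Sym2.eq_iff.1 (hedge k) with ⟨e1, e2⟩ | ⟨e1, e2⟩
    · rw [e1, e2] at hj
      obtain ⟨w, hw⟩ := hstrand (c.slope k) (-j) (by push_cast; linarith)
      refine ⟨(-j, w), ?_, Or.inl ⟨e1, e2, hw.symm⟩⟩
      rw [hw]
      push_cast
      linarith
    · rw [e1, e2] at hj
      obtain ⟨w, hw⟩ := hstrand (-c.slope k) j (by push_cast; linarith)
      refine ⟨(j, w), ?_, Or.inr ⟨e1, e2, by rw [hw, neg_neg]⟩⟩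
      rw [hw]
      push_cast
      linarith
  choose f hlen hcase using key
  have hf : IsBalanced (Γ.lowEnd Ω) (Γ.highEnd Ω) f := fun v => by
    rw [← (sum_ray_natAbs_eq_iff c.curve c.slope v).1 (c.balanced v)]
    refine Finset.sum_congr rfl fun k _ => ?_
    rcases hcase k with ⟨e1, e2, e3⟩ | ⟨e1, e2, e3⟩
    · rw [e1, e2, e3]
    · rw [e1, e2, e3]
      ring
  refine ⟨Ω, f, hf, LabeledCover.iso_of_eq_or_reverse (fun k => ?_) (fun v => (hΩ v).symm) hcase⟩
  refine mul_left_cancel₀ (by exact_mod_cast strandSlope_ne_zero (f k) : (strandSlope (f k) : ℝ) ≠ 0)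
    ((hlen k).trans ?_)
  exact (strandSlope_mul_strandLength Ω f k).symm

/-! ### The count of covers -/

theorem loopless_of_hasBranchType (h : IsSortedLift p₀ p b X) {c : LabeledCover g L}
    {a : Fin (3 * g - 3) → ℕ} (hc : c.HasBranchType p₀ p a) : Loopless c.curve.combType := by
  obtain ⟨Ω, hΩ⟩ := h.exists_perm hc.branchPoints
  refine loopless_of_injective fun u v huv => ?_
  simp only [hΩ] at huv
  exact Ω.injective (h.coe_injective huv)

theorem classes_eq_empty (h : IsSortedLift p₀ p b X) (hΓ : ¬ (IsFeynman Γ ∧ Loopless Γ))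
    (a : Fin (3 * g - 3) → ℕ) : LabeledCover.classes p₀ p {Γ} a = ∅ := by
  refine Set.eq_empty_of_forall_notMem ?_
  rintro _ ⟨c, rfl, rfl, hc⟩
  exact hΓ ⟨c.curve.isFeynman, loopless_of_hasBranchType h hc⟩

/-- The isomorphism class of the cover of a flow. -/
noncomputable def flowClass (hg : 1 < g) (h : IsSortedLift p₀ p b X) (hΓ : IsFeynman Γ)
    (hl : Loopless Γ) (a : Fin (3 * g - 3) → ℕ)
    (x : Σ Ω : Equiv.Perm (Fin (2 * g - 2)), flowSet (Γ.lowEnd Ω) (Γ.highEnd Ω) a) :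
    LabeledCover.classes p₀ p {Γ} a :=
  ⟨⟦flowCover hg h hΓ hl x.1 x.2 x.2.2.1⟧, _, rfl, flowCover_combType hg h hΓ hl x.1 x.2 x.2.2.1,
    flowCover_hasBranchType hg h hΓ hl x.1 x.2 x.2.2.1 x.2.2.2⟩

theorem flowClass_bijective (hg : 1 < g) (h : IsSortedLift p₀ p b X) (hΓ : IsFeynman Γ)
    (hl : Loopless Γ) (a : Fin (3 * g - 3) → ℕ) :
    Function.Bijective (flowClass hg h hΓ hl a) := by
  constructor
  · rintro ⟨Ω, f, hf⟩ ⟨Ω', f', hf'⟩ he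
    obtain ⟨rfl, rfl⟩ := flowCover_injective hg h hΓ hl hf.1 hf'.1
      (Quotient.exact (congrArg Subtype.val he))
    rfl
  · rintro ⟨_, c, rfl, hc, hbr⟩
    obtain ⟨Ω, f, hf, hiso⟩ := exists_iso_flowCover hg h hΓ hl hc hbr.branchPoints
    refine ⟨⟨Ω, f, hf, fun k => ?_⟩, Subtype.ext (Quotient.sound (Setoid.symm hiso))⟩
    rw [← hbr.branchType k, LabeledCover.ncard_fiber_eq_of_iso hiso,
      LabeledCover.weight_eq_of_iso hiso, flowCover_branchType]

/-- The positions in the order Ω serve as heights. -/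
theorem finite_flowSet_orientation (hl : Loopless Γ) (Ω : Equiv.Perm (Fin (2 * g - 2)))
    (a : Fin (3 * g - 3) → ℕ) : (flowSet (Γ.lowEnd Ω) (Γ.highEnd Ω) a).Finite :=
  finite_flowSet (y := fun v => ((Ω v : ℕ) : ℝ))
    (fun k => by exact_mod_cast lowEnd_lt_highEnd hl Ω k) a

theorem finite_classes_singleton (hg : 1 < g) (h : IsSortedLift p₀ p b X) (Γ : LabeledGraph g)
    (a : Fin (3 * g - 3) → ℕ) : (LabeledCover.classes p₀ p {Γ} a).Finite := by
  by_cases hΓ : IsFeynman Γ ∧ Loopless Γ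
  · have : ∀ Ω, Finite (flowSet (Γ.lowEnd Ω) (Γ.highEnd Ω) a) := fun Ω =>
      finite_flowSet_orientation hΓ.2 Ω a
    exact Finite.of_surjective _ (flowClass_bijective hg h hΓ.1 hΓ.2 a).2
  · rw [classes_eq_empty h hΓ]
    exact Set.finite_empty

theorem finite_classes (hg : 1 < g) (h : IsSortedLift p₀ p b X) (S : Set (LabeledGraph g))
    (a : Fin (3 * g - 3) → ℕ) : (LabeledCover.classes p₀ p S a).Finite := by
  rw [classes_eq_biUnion]
  exact S.toFinite.biUnion fun Γ _ => finite_classes_singleton hg h Γ a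

theorem tropCount_eq_zero (h : IsSortedLift p₀ p b X) (hΓ : ¬ Loopless Γ)
    (a : Fin (3 * g - 3) → ℕ) : tropCount p₀ p {Γ} a = 0 := by
  rw [tropCount, classes_eq_empty h fun h' => hΓ h'.2]
  exact finsum_mem_empty

theorem tropCount_singleton (hg : 1 < g) (h : IsSortedLift p₀ p b X) (hΓ : IsFeynman Γ)
    (hl : Loopless Γ) (a : Fin (3 * g - 3) → ℕ) :
    tropCount p₀ p {Γ} a = ∑ Ω : Equiv.Perm (Fin (2 * g - 2)),
      ∑ᶠ f ∈ flowSet (Γ.lowEnd Ω) (Γ.highEnd Ω) a, ∏ k, ((f k).2 : ℕ) := by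
  have : ∀ Ω, Fintype (flowSet (Γ.lowEnd Ω) (Γ.highEnd Ω) a) := fun Ω =>
    (finite_flowSet_orientation hl Ω a).fintype
  rw [tropCount, ← finsum_set_coe_eq_finsum_mem,
    ← finsum_eq_of_bijective _ (flowClass_bijective hg h hΓ hl a)
      (f := fun x => ∏ k, ((x.2.1 k).2 : ℕ)) fun x => ?_,
    finsum_eq_sum_of_fintype, Fintype.sum_sigma]
  · refine Finset.sum_congr rfl fun Ω _ => ?_
    rw [← finsum_set_coe_eq_finsum_mem, finsum_eq_sum_of_fintype]
  · exact Finset.prod_congr rfl fun k _ => (flowCover_weight hg h hΓ hl x.1 x.2 x.2.2.1 k).symm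

theorem tropCount_finset (hg : 1 < g) (h : IsSortedLift p₀ p b X) (R : Finset (LabeledGraph g))
    (a : Fin (3 * g - 3) → ℕ) :
    tropCount p₀ p (R : Set (LabeledGraph g)) a = ∑ Γ ∈ R, tropCount p₀ p {Γ} a := by
  rw [tropCount, classes_eq_biUnion, finsum_mem_biUnion ?_ R.finite_toSet
    fun Γ _ => finite_classes_singleton hg h Γ a, finsum_mem_coe_finset]
  · rfl
  -- Isomorphisms respect all labels, so covers of different labeled types are never isomorphic.
  · intro Γ _ Γ' _ hne
    refine Set.disjoint_left.2 ?_
    rintro _ ⟨c, rfl, rfl, -⟩ ⟨c', hx, rfl, -⟩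
    exact hne (LabeledCover.combType_eq_of_iso (Quotient.exact hx)).symm

/-! ### Feynman integrals -/

theorem IsStart.lowEnd_lt_highEnd {τ : Fin (3 * g - 3) → UpperHalfPlane}
    {Ω : Equiv.Perm (Fin (2 * g - 2))} {y : Fin (2 * g - 2) → ℝ} (hy : IsStart τ Ω y)
    (hl : Loopless Γ) (k : Fin (3 * g - 3)) : y (Γ.lowEnd Ω k) < y (Γ.highEnd Ω k) :=
  hy.order _ _ (LabeledGraph.lowEnd_lt_highEnd hl Ω k)

theorem IsStart.sub_lt {τ : Fin (3 * g - 3) → UpperHalfPlane}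
    {Ω : Equiv.Perm (Fin (2 * g - 2))} {y : Fin (2 * g - 2) → ℝ} (hy : IsStart τ Ω y)
    (k : Fin (3 * g - 3)) : y (Γ.highEnd Ω k) - y (Γ.lowEnd Ω k) < (τ k).im :=
  (le_abs_self _).trans_lt (hy.small _ _ k)

theorem integrableOn_integrand (hl : Loopless Γ) {τ : Fin (3 * g - 3) → UpperHalfPlane}
    {Ω : Equiv.Perm (Fin (2 * g - 2))} {y : Fin (2 * g - 2) → ℝ} (hy : IsStart τ Ω y) :
    MeasureTheory.IntegrableOn (integrand Γ τ y) (Set.Icc 0 1) := by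
  rw [funext (integrand_eq_orientedIntegrand Γ τ Ω y)]
  exact (continuous_orientedIntegrand (hy.lowEnd_lt_highEnd hl)
    hy.sub_lt).continuousOn.integrableOn_compact isCompact_Icc

theorem hasSum_tropCount_singleton (hg : 1 < g) (h : IsSortedLift p₀ p b X) (hΓ : IsFeynman Γ)
    (hl : Loopless Γ) {τ : Fin (3 * g - 3) → UpperHalfPlane}
    {y : Equiv.Perm (Fin (2 * g - 2)) → Fin (2 * g - 2) → ℝ} (hy : ∀ Ω, IsStart τ Ω (y Ω)) :
    HasSum (fun a => (tropCount p₀ p {Γ} a : ℂ) * qMonomial τ a) (feynmanIntegral Γ τ y) := by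
  have hs := hasSum_sum fun Ω (_ : Ω ∈ Finset.univ) =>
    hasSum_flowCount ((hy Ω).lowEnd_lt_highEnd hl) (hy Ω).sub_lt
  have hI : feynmanIntegral Γ τ y = ∑ Ω, ∫ t in Set.Icc (0 : Fin (2 * g - 2) → ℝ) 1,
      orientedIntegrand τ (Γ.lowEnd Ω) (Γ.highEnd Ω) (y Ω) t :=
    Finset.sum_congr rfl fun Ω _ => by
      rw [feynmanIntegralAt, funext (integrand_eq_orientedIntegrand Γ τ Ω (y Ω))]
  rw [hI]
  refine hs.congr_fun fun a => ?_
  rw [tropCount_singleton hg h hΓ hl, Nat.cast_sum, Finset.sum_mul]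

open Classical in
theorem hasSum_tropCount_finset (hg : 1 < g) (h : IsSortedLift p₀ p b X)
    {R : Finset (LabeledGraph g)} (hR : ∀ Γ ∈ R, IsFeynman Γ)
    {τ : Fin (3 * g - 3) → UpperHalfPlane}
    {y : Equiv.Perm (Fin (2 * g - 2)) → Fin (2 * g - 2) → ℝ} (hy : ∀ Ω, IsStart τ Ω (y Ω)) :
    HasSum (fun a => (tropCount p₀ p (R : Set (LabeledGraph g)) a : ℂ) * qMonomial τ a)
      (∑ Γ ∈ R with Loopless Γ, feynmanIntegral Γ τ y) := by
  refine (hasSum_sum (f := fun Γ a => (tropCount p₀ p {Γ} a : ℂ) * qMonomial τ a)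
    fun Γ hΓ => ?_).congr_fun fun a => ?_
  · rw [Finset.mem_filter] at hΓ
    exact hasSum_tropCount_singleton hg h (hR Γ hΓ.1) hΓ.2 hy
  · rw [tropCount_finset hg h, Nat.cast_sum, Finset.sum_mul, Finset.sum_filter]
    refine Finset.sum_congr rfl fun Γ _ => ?_
    split_ifs with hl
    · rfl
    · rw [tropCount_eq_zero h hl, Nat.cast_zero, zero_mul]

end TropicalMirror

/-! ### Tropical mirror symmetry for elliptic curves -/

open TropicalMirror LabeledGraph in
open Classical in
theorem mainTheorem1 (g : ℕ) (hg : 1 < g) (L : ℝ) [Fact (0 < L)]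
    (p₀ : AddCircle L) (p : Fin (2 * g - 2) → AddCircle L)
    (hp : Function.Injective p) (hp₀ : p₀ ∉ Set.range p) :
    -- the counts are finite
    (∀ a, (LabeledCover.classes p₀ p (Set.univ : Set (LabeledGraph g)) a).Finite) ∧
    -- a Feynman graph with a loop is not the type of a cover that is counted
    (∀ Γ : LabeledGraph g, IsFeynman Γ → ¬ Loopless Γ → ∀ a, tropCount p₀ p {Γ} a = 0) ∧
    ∀ (τ : Fin (3 * g - 3) → UpperHalfPlane)
      (y : Equiv.Perm (Fin (2 * g - 2)) → Fin (2 * g - 2) → ℝ), (∀ Ω, IsStart τ Ω (y Ω)) →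
      -- the integral of each graph: its `q^{2a}`-coefficient is `N_{a,Γ}`
      (∀ Γ : LabeledGraph g, IsFeynman Γ → Loopless Γ →
        (∀ Ω, MeasureTheory.IntegrableOn (integrand Γ τ (y Ω)) (Set.Icc 0 1)) ∧
        HasSum (fun a => (tropCount p₀ p {Γ} a : ℂ) * qMonomial τ a) (feynmanIntegral Γ τ y)) ∧
      -- the generating function `F_g`, both for one reference labeling of each graph and for
      -- all labelings
      (∀ R : Finset (LabeledGraph g), (IsReferenceSystem R ∨ ∀ Γ, Γ ∈ R ↔ IsFeynman Γ) →
        HasSum (fun a => (tropCount p₀ p (R : Set (LabeledGraph g)) a : ℂ) * qMonomial τ a)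
          (∑ Γ ∈ R with Loopless Γ, feynmanIntegral Γ τ y)) := by
  obtain ⟨b, X, h⟩ := exists_isSortedLift hp hp₀
  refine ⟨finite_classes hg h Set.univ, fun Γ _ hΓ => tropCount_eq_zero h hΓ, fun τ y hy =>
    ⟨fun Γ hΓ hl => ⟨fun Ω => integrableOn_integrand hl (hy Ω),
      hasSum_tropCount_singleton hg h hΓ hl hy⟩, fun R hR => hasSum_tropCount_finset hg h ?_ hy⟩⟩
  rcases hR with hR | hR
  · exact hR.isFeynman
  · exact fun Γ => (hR Γ).1
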